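/- **Setting.** Let $E$ be a Hausdorff topological space whose Borel $\sigma$-algebra is generated by the continuous real functions on $E$, let $\mu$ be a $\sigma$-finite positive measure on it, and let $\mathcal H=L^2(E,\mu)$ (real) with inner product $(\cdot,\cdot)$. A *Dirichlet form* on $\mathcal H$ (not necessarily symmetric) is a non-negative bilinear form $\mathcal B$ on a dense linear subspace $D(\mathcal B)$ of $\mathcal H$ that is complete for the norm $(\mathcal B(u,u)+(u,u))^{1/2}$, satisfies the weak sector condition $|\mathcal B_1(u,v)|\le K\,\mathcal B_1(u,u)^{1/2}\mathcal B_1(v,v)^{1/2}$ for some $K>0$, where $\mathcal B_1=\mathcal B+(\cdot,\cdot)$, and for which $u\in D(\mathcal B)$ implies $w:=u^+\wedge 1\in D(\mathcal B)$, $\mathcal B(u+w,u-w)\ge 0$ and $\mathcal B(u-w,u+w)\ge0$. It is *sectorial* if moreover, for some $K>0$, $|\mathcal B(u,v)|\le K\,\mathcal B(u,u)^{1/2}\mathcal B(v,v)^{1/2}$ for all $u,v\in D(\mathcal B)$. Its semigroup is the $C_0$-semigroup of contractions on $\mathcal H$ whose resolvent $(G_\alpha)_{\alpha>0}$ satisfies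 $G_\alpha\mathcal H\subset D(\mathcal B)$ and $\mathcal B(G_\alpha f,v)+\alpha(G_\alpha f,v)=(f,v)$ for $f\in\mathcal H$, $v\in D(\mathcal B)$. Its symmetric part is $\widetilde{\mathcal B}(u,v)=\frac12(\mathcal B(u,v)+\mathcal B(v,u))$ on $D(\mathcal B)$. A bounded operator $S$ on $\mathcal H$ is *sub-Markovian* if $0\le f\le1$ a.e. implies $0\le Sf\le 1$ a.e. Let $(\mathcal A,\mathcal V)$ be a Dirichlet form on $\mathcal H$, $\mathcal V$ carrying the norm $(\mathcal A(u,u)+(u,u))^{1/2}$, with dual $\mathcal V'\supset\mathcal H$. Assume that * (H1) $(\Lambda,D(\Lambda,\mathcal H))$ is a linear operator generating a sub-Markovian $C_0$-semigroup of contractions $(U_t)_{t>0}$ on $\mathcal H$ that can be restricted to a $C_0$-semigroup on $\mathcal V$. Let $(\Lambda,\mathcal F)$ be the closure of $\Lambda:D(\Lambda,\mathcal H)\cap\mathcal V\to\mathcal V'$, and let $\mathcal E(u,v)=\mathcal A(u,v)-{}_{\mathcal V'}\langle\Lambda u,v\rangle_{\mathcal V}$ for $u\in\mathcal F$, $v\in\mathcal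 V$. Let $(G_\alpha)_{\alpha>0}$ be the $C_0$-resolvent of contractions on $\mathcal H$ with $G_\alpha\mathcal H\subset\mathcal F$ and $\mathcal E(G_\alpha f,g)+\alpha(G_\alpha f,g)=(f,g)$ for $f\in\mathcal H$, $g\in\mathcal V$, let $(L,D(L))$ be its generator, and let $(T_t)_{t>0}$ be the $C_0$-semigroup of contractions on $\mathcal H$ with generator $L$. Assume that * (H2) the adjoint semigroup $(\widehat T_t)_{t>0}$ is sub-Markovian. Let $D(L)_b$ be the set of $\mu$-essentially bounded $u\in D(L)$. A semigroup $(T_t)_{t>0}$ as above (that of $\mathcal E$, or that of a sectorial Dirichlet form) restricted to $L^1\cap L^2$ extends to a $C_0$-semigroup of contractions on $L^1(E,\mu)$, again denoted $(T_t)$; it is called *transient* if there is $g\in L^1(E,\mu)$ with $g>0$ $\mu$-a.e. and $$Gg:=\lim_{N\to\infty}\int_0^N T_tg\,dt<\infty\quad\mu\text{-a.e.}$$ A sectorial Dirichlet form is called transient if its semigroup is. **Theorem 2.4.** 1. Let $(\mathcal E^0,D(\mathcal E^0))$ be a sectorial Dirichlet form on $\mathcal H$ such that $D(L)_b\subset D(\mathcal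 E^0)$ and $\mathcal E^0(u,u)\le\mathcal E(u,u)$ for all $u\in D(L)_b$. If $(\mathcal E^0,D(\mathcal E^0))$ is transient, then $(T_t)_{t>0}$ is transient. 2. In particular, if $(\mathcal E^0,D(\mathcal E^0))$ is any sectorial Dirichlet form on $\mathcal H$, then its symmetric part $(\widetilde{\mathcal E}^0,D(\mathcal E^0))$ is a Dirichlet form, and $(\mathcal E^0,D(\mathcal E^0))$ is transient if and only if $(\widetilde{\mathcal E}^0,D(\mathcal E^0))$ is transient. -/

import Mathlib

open MeasureTheory Filter Topology

noncomputable section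

namespace GenDirichlet

/-! ### Semigroups, resolvents and their generators -/

section Operators

variable {X : Type*} [NormedAddCommGroup X] [NormedSpace ℝ X]

/-- `(T_t)_{t ≥ 0}` is a `C₀`-semigroup of contractions on `X`
(values of `T` at negative times are irrelevant). -/
structure IsC0ContractionSemigroup (T : ℝ → X →L[ℝ] X) : Prop where
  zero : T 0 = ContinuousLinearMap.id ℝ X
  add : ∀ s t : ℝ, 0 ≤ s → 0 ≤ t → T (s + t) = (T s).comp (T t)
  contraction : ∀ t : ℝ, 0 ≤ t → ‖T t‖ ≤ 1
  continuous : ∀ f : X, Tendsto (fun t => T t f) (𝓝[>] 0) (𝓝 f)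

/-- The (in general unbounded) operator `L` is the generator of the semigroup `(T_t)`. -/
def IsSemigroupGenerator (L : X →ₗ.[ℝ] X) (T : ℝ → X →L[ℝ] X) : Prop :=
  ∀ u f : X, (u, f) ∈ L.graph ↔
    Tendsto (fun t : ℝ => t⁻¹ • (T t u - u)) (𝓝[>] 0) (𝓝 f)

/-- `(G_α)_{α > 0}` is a `C₀`-resolvent of contractions on `X`. -/
structure IsC0ContractionResolvent (G : ℝ → X →L[ℝ] X) : Prop where
  resolvent : ∀ α β : ℝ, 0 < α → 0 < β → G α - G β = (β - α) • (G α).comp (G β)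
  contraction : ∀ α : ℝ, 0 < α → ‖α • G α‖ ≤ 1
  continuous : ∀ f : X, Tendsto (fun α : ℝ => α • G α f) atTop (𝓝 f)

/-- The operator `L` is the generator of the resolvent `(G_α)`, i.e. `G_α = (α - L)⁻¹`. -/
def IsResolventGenerator (L : X →ₗ.[ℝ] X) (G : ℝ → X →L[ℝ] X) : Prop :=
  ∀ α : ℝ, 0 < α → ∀ f u : X, G α f = u ↔ (u, α • u - f) ∈ L.graph

end Operators

/-! ### Dirichlet forms on `L²` -/

/-- A real bilinear form defined on a linear subspace `dom` of `H`. -/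
structure PartialForm (H : Type*) [NormedAddCommGroup H] [InnerProductSpace ℝ H] where
  dom : Submodule ℝ H
  form : dom →ₗ[ℝ] dom →ₗ[ℝ] ℝ

section Forms

variable {H : Type*} [NormedAddCommGroup H] [InnerProductSpace ℝ H]

/-- The norm `(B(u,u) + (u,u))^{1/2}` on the domain of the form. -/
def PartialForm.norm1 (B : PartialForm H) (u : B.dom) : ℝ :=
  Real.sqrt (B.form u u + ‖(u : H)‖ ^ 2)

/-- The symmetric part `(B(u,v) + B(v,u)) / 2`, on the same domain. -/
def PartialForm.symPart (B : PartialForm H) : PartialForm H where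
  dom := B.dom
  form := (1 / 2 : ℝ) • (B.form + B.form.flip)

/-- Coercive closed form: densely defined, non-negative, complete with respect to `norm1`, and
satisfying the weak sector condition. -/
structure IsCoerciveClosedForm (B : PartialForm H) : Prop where
  dense : Dense (B.dom : Set H)
  nonneg : ∀ u : B.dom, 0 ≤ B.form u u
  complete : ∀ w : ℕ → B.dom,
    (∀ ε : ℝ, 0 < ε → ∃ N : ℕ, ∀ m ≥ N, ∀ n ≥ N, B.norm1 (w m - w n) < ε) →
    ∃ u : B.dom, Tendsto (fun n => B.norm1 (w n - u)) atTop (𝓝 0)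
  weakSector : ∃ K : ℝ, 0 < K ∧ ∀ u v : B.dom,
    |B.form u v + inner ℝ (u : H) (v : H)| ≤ K * B.norm1 u * B.norm1 v

/-- The strong sector condition. -/
def IsSectorial (B : PartialForm H) : Prop :=
  ∃ K : ℝ, 0 < K ∧ ∀ u v : B.dom,
    |B.form u v| ≤ K * Real.sqrt (B.form u u) * Real.sqrt (B.form v v)

/-- `(G_α)` is the resolvent of the form `B`: `G_α H ⊆ dom B` and
`B(G_α f, v) + α (G_α f, v) = (f, v)` for all `v ∈ dom B`. -/
def IsFormResolvent (B : PartialForm H) (G : ℝ → H →L[ℝ] H) : Prop :=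
  IsC0ContractionResolvent G ∧
  ∀ α : ℝ, 0 < α → ∀ f : H, ∃ u : B.dom, (u : H) = G α f ∧
    ∀ v : B.dom, B.form u v + α * inner ℝ (u : H) (v : H) = inner ℝ f (v : H)

/-- `(T_t)` is the `C₀`-semigroup of contractions associated with the form `B`: it has the same
generator as the resolvent of `B`. -/
def IsFormSemigroup (B : PartialForm H) (T : ℝ → H →L[ℝ] H) : Prop :=
  IsC0ContractionSemigroup T ∧ ∃ (G : ℝ → H →L[ℝ] H) (L : H →ₗ.[ℝ] H),
    IsFormResolvent B G ∧ IsResolventGenerator L G ∧ IsSemigroupGenerator L T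

/-! ### The form associated with `(A, V)` and `Λ`, where `V = dom A` -/

/-- The semigroup `(U_t)` on `H` can be restricted to a `C₀`-semigroup (of bounded operators, not
necessarily contractions) on `V = dom A` with the norm `A.norm1`. -/
def RestrictsToC0Semigroup (U : ℝ → H →L[ℝ] H) (A : PartialForm H) : Prop :=
  ∃ W : ℝ → A.dom →ₗ[ℝ] A.dom,
    (∀ t : ℝ, 0 ≤ t → ∀ v : A.dom, (W t v : H) = U t (v : H)) ∧
    (∀ t : ℝ, 0 ≤ t → ∃ C : ℝ, ∀ v : A.dom, A.norm1 (W t v) ≤ C * A.norm1 v) ∧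
    ∀ v : A.dom, Tendsto (fun t => A.norm1 (W t v - v)) (𝓝[>] 0) (𝓝 0)

/-- The pair `(u, ℓ)` belongs to the graph of the closure of `Λ : D(Λ) ∩ V → V'`, where `h ∈ H` is
identified with the functional `v ↦ (h, v)` on `V`: there are `wₙ ∈ D(Λ) ∩ V` with `wₙ → u` in `V`
and `Λ wₙ → ℓ` in the dual norm of `V'`. (Such an `ℓ` is automatically bounded on `V`.) -/
def InClosureGraph (A : PartialForm H) (Λ : H →ₗ.[ℝ] H)
    (u : A.dom) (ℓ : A.dom →ₗ[ℝ] ℝ) : Prop :=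
  ∃ (w : ℕ → A.dom) (f : ℕ → H),
    (∀ n, ((w n : H), f n) ∈ Λ.graph) ∧
    Tendsto (fun n => A.norm1 (w n - u)) atTop (𝓝 0) ∧
    ∀ ε : ℝ, 0 < ε → ∀ᶠ n in atTop, ∀ v : A.dom,
      |inner ℝ (f n) (v : H) - ℓ v| ≤ ε * A.norm1 v

/-- The space `F`, i.e. the domain of the closure of `Λ : D(Λ) ∩ V → V'`. -/
def closureDomain (A : PartialForm H) (Λ : H →ₗ.[ℝ] H) : Set A.dom :=
  {u | ∃ ℓ, InClosureGraph A Λ u ℓ}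

open Classical in
/-- The closure of `Λ : D(Λ) ∩ V → V'`, with value `0` outside of `F`. -/
def closureMap (A : PartialForm H) (Λ : H →ₗ.[ℝ] H) (u : A.dom) : A.dom →ₗ[ℝ] ℝ :=
  if h : ∃ ℓ, InClosureGraph A Λ u ℓ then h.choose else 0

/-- The bilinear form associated with `(A, V)` and `Λ`: `ℰ(u, v) = A(u, v) - ⟨Λ u, v⟩` for `u ∈ F`
and `v ∈ V`. -/
def genForm (A : PartialForm H) (Λ : H →ₗ.[ℝ] H) (u v : A.dom) : ℝ :=
  A.form u v - closureMap A Λ u v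

/-- `(G_α)` is the resolvent associated with `ℰ = genForm A Λ`: `G_α H ⊆ F` and
`ℰ(G_α f, g) + α (G_α f, g) = (f, g)` for `f ∈ H`, `g ∈ V`. -/
def IsGenFormResolvent (A : PartialForm H) (Λ : H →ₗ.[ℝ] H) (G : ℝ → H →L[ℝ] H) : Prop :=
  IsC0ContractionResolvent G ∧
  ∀ α : ℝ, 0 < α → ∀ f : H, ∃ u ∈ closureDomain A Λ, (u : H) = G α f ∧
    ∀ g : A.dom, genForm A Λ u g + α * inner ℝ (u : H) (g : H) = inner ℝ f (g : H)

/-- `L` is the generator and `(T_t)` the `C₀`-semigroup of contractions associated with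
`ℰ = genForm A Λ`. -/
def IsGenFormSemigroup (A : PartialForm H) (Λ L : H →ₗ.[ℝ] H) (T : ℝ → H →L[ℝ] H) : Prop :=
  IsC0ContractionSemigroup T ∧ IsSemigroupGenerator L T ∧
    ∃ G : ℝ → H →L[ℝ] H, IsGenFormResolvent A Λ G ∧ IsResolventGenerator L G

end Forms

section Markov

variable {E : Type*} [MeasurableSpace E] {μ : Measure E}

/-- Dirichlet form (not necessarily symmetric) on `L²(E, μ)`: a coercive closed form such that
`u⁺ ∧ 1` is in the domain for all `u` in the domain, and
`B(u + u⁺ ∧ 1, u - u⁺ ∧ 1) ≥ 0` and `B(u - u⁺ ∧ 1, u + u⁺ ∧ 1) ≥ 0`. -/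
structure IsDirichletForm (B : PartialForm (Lp ℝ 2 μ)) : Prop extends
    IsCoerciveClosedForm B where
  unitContraction : ∀ u : B.dom, ∃ w : B.dom,
    ((w : Lp ℝ 2 μ) =ᵐ[μ] fun x => min (max ((u : Lp ℝ 2 μ) x) 0) 1) ∧
    0 ≤ B.form (u + w) (u - w) ∧ 0 ≤ B.form (u - w) (u + w)

/-- `0 ≤ f ≤ 1` a.e. implies `0 ≤ S f ≤ 1` a.e. -/
def IsSubMarkovian (S : Lp ℝ 2 μ →L[ℝ] Lp ℝ 2 μ) : Prop :=
  ∀ f : Lp ℝ 2 μ, (∀ᵐ x ∂μ, 0 ≤ f x ∧ f x ≤ 1) → ∀ᵐ x ∂μ, 0 ≤ S f x ∧ S f x ≤ 1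

/-- `u` is `μ`-essentially bounded. -/
def IsEssBounded (u : Lp ℝ 2 μ) : Prop := ∃ C : ℝ, ∀ᵐ x ∂μ, |u x| ≤ C

/-- `(S_t)` is the extension of `(T_t)` from `L¹ ∩ L²` to a `C₀`-semigroup of contractions
on `L¹`. -/
def IsL1Extension (T : ℝ → Lp ℝ 2 μ →L[ℝ] Lp ℝ 2 μ)
    (S : ℝ → Lp ℝ 1 μ →L[ℝ] Lp ℝ 1 μ) : Prop :=
  IsC0ContractionSemigroup S ∧
  ∀ t : ℝ, 0 < t → ∀ (f : Lp ℝ 2 μ) (g : Lp ℝ 1 μ), f =ᵐ[μ] g → T t f =ᵐ[μ] S t g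

/-- The potential `G f = lim_{N → ∞} ∫₀ᴺ S_t f dt` of a (non-negative) `f ∈ L¹`, with values in
`[0, ∞]`. The limit is increasing `μ`-a.e., so it is the supremum over `N ∈ ℕ`. -/
def potential (S : ℝ → Lp ℝ 1 μ →L[ℝ] Lp ℝ 1 μ) (f : Lp ℝ 1 μ) (x : E) : ENNReal :=
  ⨆ N : ℕ, ENNReal.ofReal ((∫ t in (0 : ℝ)..(N : ℝ), S t f : Lp ℝ 1 μ) x)

/-- `(T_t)` is transient: there is `g ∈ L¹` with `g > 0` a.e. and `G g < ∞` a.e. -/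
def IsTransient (T : ℝ → Lp ℝ 2 μ →L[ℝ] Lp ℝ 2 μ) : Prop :=
  ∃ S : ℝ → Lp ℝ 1 μ →L[ℝ] Lp ℝ 1 μ, IsL1Extension T S ∧
    ∃ g : Lp ℝ 1 μ, (∀ᵐ x ∂μ, 0 < g x) ∧ ∀ᵐ x ∂μ, potential S g x < ⊤

end Markov

end GenDirichlet

end

/-!
# Transience of generalized Dirichlet forms by domination

Transience of a semigroup `(T_t)` amounts to the existence of a strictly positive integrable
function `f` with values in `[0, 1]` and finite energy `∫₀^∞ (f, T_t f) dt = sup_α (f, G_α f)`.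
From a transience witness `g` for `(T_t)` one gets such an `f` by dividing `g ∧ 1` by `1 + G g`,
because then `f · G f ≤ g` (`IsTransient.exists_finite_energy`); conversely the energy is the
integral of `f · G f`, so that `G f` is finite almost everywhere (`isTransient_of_finite_energy`).

Let `B` be a transient sectorial Dirichlet form, and let `f` have finite energy for `B`. Since
`(f, v) = B(G⁰_α f, v) + α (G⁰_α f, v)`, the sector condition gives `(f, v) ≤ C B(v, v)^{1/2}` for all
`v` in the domain (`inner_le_of_isSectorial`). If the energy of another resolvent `(G_α)` dominates
`B`, the choice `v = G_α f` yields `(f, G_α f) ≤ C B(v, v)^{1/2} ≤ C (f, G_α f)^{1/2}`, hence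
`(f, G_α f) ≤ C²` uniformly in `α`: the function `f` also has finite energy for `(G_α)`
(`isTransient_of_domination`). Neither this argument nor the rest of the file uses the adjoint form.

What remains are Markov properties. For `v = G_α f` to be bounded the resolvent has to be
sub-Markovian. This follows by testing the resolvent equation with `u - u⁺ ∧ 1`; for a generalized
form the contribution of `Λ` has the right sign on `D(Λ) ∩ V`, and a weak convergence argument
carries the sign to the closure (`InClosureGraph.apply_sub_nonpos`). The extension to `L¹` is
constructed from the sub-Markov property of the adjoint semigroup (`exists_isL1Extension`). For the
semigroup of a Dirichlet form that property comes from testing the resolvent equation with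
`(n u)⁺ ∧ 1`, `n → ∞`, which shows that `α G_α` is a contraction for the `L¹`-norm
(`IsFormResolvent.smul_apply_mem_massAtMost`), and from the implicit Euler scheme
(`semigroup_apply_mem_of_resolvent`).

A sectorial Dirichlet form and its symmetric part have the same quadratic form, so each dominates
the other.
-/

noncomputable section

namespace GenDirichlet

/-! ### Contraction semigroups and their resolvents -/

section Semigroups

variable {X : Type*} [NormedAddCommGroup X] [NormedSpace ℝ X]

theorem IsC0ContractionSemigroup.norm_apply_le {T : ℝ → X →L[ℝ] X}
    (hT : IsC0ContractionSemigroup T) {t : ℝ} (ht : 0 ≤ t) (f : X) : ‖T t f‖ ≤ ‖f‖ := by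
  simpa using (T t).le_of_opNorm_le (hT.contraction t ht) f

theorem IsC0ContractionSemigroup.add_apply {T : ℝ → X →L[ℝ] X}
    (hT : IsC0ContractionSemigroup T) {s t : ℝ} (hs : 0 ≤ s) (ht : 0 ≤ t) (f : X) :
    T (s + t) f = T s (T t f) := by
  rw [hT.add s t hs ht]; rfl

theorem IsC0ContractionSemigroup.norm_sub_apply_le {T : ℝ → X →L[ℝ] X}
    (hT : IsC0ContractionSemigroup T) {s t : ℝ} (hs : 0 ≤ s) (ht : 0 ≤ t) (f : X) :
    ‖T t f - T s f‖ ≤ ‖T |t - s| f - f‖ := by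
  wlog h : s ≤ t generalizing s t
  · rw [norm_sub_rev, abs_sub_comm]
    exact this ht hs (le_of_not_ge h)
  · have h0 : 0 ≤ t - s := sub_nonneg.2 h
    have : T t f = T s (T (t - s) f) := by
      rw [← hT.add_apply hs h0]; congr 2; ring
    rw [this, ← map_sub, abs_of_nonneg h0]
    exact hT.norm_apply_le hs _

/-- The orbit of a `C₀`-semigroup of contractions, frozen at negative times, where the semigroup
carries no information, is continuous. -/
theorem IsC0ContractionSemigroup.continuous_orbit {T : ℝ → X →L[ℝ] X}
    (hT : IsC0ContractionSemigroup T) (f : X) : Continuous fun t : ℝ => T (max t 0) f := by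
  rw [continuous_iff_continuousAt]
  intro s
  have h0 : Tendsto (fun t : ℝ => T t f) (𝓝[≥] 0) (𝓝 f) := by
    rw [← Set.Ioi_insert, nhdsWithin_insert, tendsto_sup]
    refine ⟨?_, hT.continuous f⟩
    rw [tendsto_pure_left]
    intro U hU
    simpa [hT.zero] using mem_of_mem_nhds hU
  have h1 : Tendsto (fun t : ℝ => |max t 0 - max s 0|) (𝓝 s) (𝓝[≥] 0) := by
    refine tendsto_nhdsWithin_iff.2 ⟨?_, Eventually.of_forall fun t => Set.mem_Ici.2 (abs_nonneg _)⟩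
    have : Continuous fun t : ℝ => |max t 0 - max s 0| := by fun_prop
    simpa using this.tendsto s
  have h2 := (tendsto_iff_norm_sub_tendsto_zero.1 h0).comp h1
  refine tendsto_iff_norm_sub_tendsto_zero.2
    (squeeze_zero (fun _ => norm_nonneg _) (fun t => ?_) h2)
  exact hT.norm_sub_apply_le (le_max_right _ _) (le_max_right _ _) f

theorem resolvent_apply_mem_graph {L : X →ₗ.[ℝ] X} {G : ℝ → X →L[ℝ] X}
    (hG : IsResolventGenerator L G) {α : ℝ} (hα : 0 < α) (f : X) :
    (G α f, α • G α f - f) ∈ L.graph := (hG α hα f _).1 rfl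

theorem semigroup_apply_mem_graph {L : X →ₗ.[ℝ] X} {T : ℝ → X →L[ℝ] X}
    (hT : IsC0ContractionSemigroup T) (hL : IsSemigroupGenerator L T) {s : ℝ} (hs : 0 ≤ s)
    {u f : X} (h : (u, f) ∈ L.graph) : (T s u, T s f) ∈ L.graph := by
  rw [hL] at h ⊢
  refine (((T s).continuous.tendsto f).comp h).congr' ?_
  filter_upwards [self_mem_nhdsWithin] with t ht
  have ht : (0 : ℝ) < t := ht
  simp only [Function.comp_apply, map_smul, map_sub]
  rw [← hT.add_apply hs ht.le, ← hT.add_apply ht.le hs, add_comm]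

theorem semigroup_resolvent_comm {L : X →ₗ.[ℝ] X} {G T : ℝ → X →L[ℝ] X}
    (hT : IsC0ContractionSemigroup T) (hL : IsSemigroupGenerator L T)
    (hG : IsResolventGenerator L G) {s α : ℝ} (hs : 0 ≤ s) (hα : 0 < α) (f : X) :
    G α (T s f) = T s (G α f) := by
  rw [hG α hα]
  simpa using semigroup_apply_mem_graph hT hL hs (resolvent_apply_mem_graph hG hα f)

theorem norm_semigroup_sub_pow_resolvent_le {L : X →ₗ.[ℝ] X} {G T : ℝ → X →L[ℝ] X}
    (hT : IsC0ContractionSemigroup T) (hL : IsSemigroupGenerator L T)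
    (hGr : IsC0ContractionResolvent G) (hG : IsResolventGenerator L G) {h : ℝ} (hh : 0 < h)
    (u : X) (n : ℕ) :
    ‖T (n * h) u - ((h⁻¹ • G h⁻¹) ^ n) u‖ ≤ n * ‖T h u - (h⁻¹ • G h⁻¹) u‖ := by
  induction n with
  | zero => simp [hT.zero]
  | succ n ih =>
    have hn : 0 ≤ (n : ℝ) * h := by positivity
    have key : T ((n + 1 : ℕ) * h) u - ((h⁻¹ • G h⁻¹) ^ (n + 1)) u
        = T (n * h) (T h u - (h⁻¹ • G h⁻¹) u)
          + (h⁻¹ • G h⁻¹) (T (n * h) u - ((h⁻¹ • G h⁻¹) ^ n) u) := by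
      have e1 : T ((n + 1 : ℕ) * h) u = T (n * h) (T h u) := by
        rw [← hT.add_apply hn hh.le]; congr 2; push_cast; ring
      have e2 : (h⁻¹ • G h⁻¹) (T (n * h) u) = T (n * h) ((h⁻¹ • G h⁻¹) u) := by
        simp [semigroup_resolvent_comm hT hL hG hn (inv_pos.2 hh)]
      rw [map_sub, map_sub, e1, e2, pow_succ']
      simp
    rw [key]
    refine (norm_add_le _ _).trans ?_
    have h1 := hT.norm_apply_le hn (T h u - (h⁻¹ • G h⁻¹) u)
    have h2 : ‖(h⁻¹ • G h⁻¹) (T (n * h) u - ((h⁻¹ • G h⁻¹) ^ n) u)‖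
        ≤ ‖T (n * h) u - ((h⁻¹ • G h⁻¹) ^ n) u‖ := by
      simpa only [one_mul] using ContinuousLinearMap.le_of_opNorm_le _
        (hGr.contraction h⁻¹ (inv_pos.2 hh)) (T (n * h) u - ((h⁻¹ • G h⁻¹) ^ n) u)
    rw [Nat.cast_succ, add_mul, one_mul]
    linarith

/-- The implicit Euler scheme converges on the domain of the generator. The steps
`T h u - h⁻¹ G h⁻¹ u` are `o(h)` because both difference quotients converge to `L u`. -/
theorem tendsto_pow_resolvent {L : X →ₗ.[ℝ] X} {G T : ℝ → X →L[ℝ] X}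
    (hT : IsC0ContractionSemigroup T) (hL : IsSemigroupGenerator L T)
    (hGr : IsC0ContractionResolvent G) (hG : IsResolventGenerator L G) {t : ℝ} (ht : 0 < t)
    {u f : X} (hu : (u, f) ∈ L.graph) :
    Tendsto (fun n : ℕ => (((t / n)⁻¹ • G (t / n)⁻¹) ^ n) u) atTop (𝓝 (T t u)) := by
  have h1 := (hL u f).1 hu
  have h2 : Tendsto (fun h : ℝ => h⁻¹ • ((h⁻¹ • G h⁻¹) u - u)) (𝓝[>] 0) (𝓝 f) := by
    refine ((hGr.continuous f).comp tendsto_inv_nhdsGT_zero).congr' ?_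
    filter_upwards [self_mem_nhdsWithin] with h hh
    have hh : (0 : ℝ) < h := hh
    have : G h⁻¹ (h⁻¹ • u - f) = u := (hG _ (inv_pos.2 hh) _ _).2 (by simpa using hu)
    rw [map_sub, map_smul] at this
    have e : (h⁻¹ • G h⁻¹) u - u = G h⁻¹ f := by
      rw [sub_eq_iff_eq_add, ← sub_eq_iff_eq_add']
      exact this
    rw [e]
    rfl
  have h3 : Tendsto (fun h : ℝ => t * ‖h⁻¹ • (T h u - (h⁻¹ • G h⁻¹) u)‖) (𝓝[>] 0) (𝓝 0) := by
    have := ((h1.sub h2).norm).const_mul t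
    simp only [sub_self, norm_zero, mul_zero] at this
    refine this.congr fun h => ?_
    rw [← smul_sub]; congr 3; abel
  have h4 : Tendsto (fun n : ℕ => t / (n : ℝ)) atTop (𝓝[>] 0) := by
    refine tendsto_nhdsWithin_iff.2 ⟨tendsto_const_div_atTop_nhds_zero_nat t, ?_⟩
    filter_upwards [eventually_gt_atTop 0] with n hn
    have : (0 : ℝ) < n := by exact_mod_cast hn
    exact div_pos ht this
  refine tendsto_iff_norm_sub_tendsto_zero.2 (squeeze_zero' (Eventually.of_forall fun _ =>
    norm_nonneg _) ?_ (h3.comp h4))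
  filter_upwards [eventually_gt_atTop 0] with n hn
  have hn : (0 : ℝ) < n := by exact_mod_cast hn
  have hh : 0 < t / n := div_pos ht hn
  have := norm_semigroup_sub_pow_resolvent_le hT hL hGr hG hh u n
  rw [mul_div_cancel₀ _ hn.ne'] at this
  rw [norm_sub_rev]
  refine this.trans (le_of_eq ?_)
  simp only [Function.comp_apply, norm_smul, norm_inv, Real.norm_eq_abs, abs_of_pos hh]
  field_simp

/-- A closed set that is invariant under all `α G_α` is invariant under the semigroup. -/
theorem semigroup_apply_mem_of_resolvent {L : X →ₗ.[ℝ] X} {G T : ℝ → X →L[ℝ] X}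
    (hT : IsC0ContractionSemigroup T) (hL : IsSemigroupGenerator L T)
    (hGr : IsC0ContractionResolvent G) (hG : IsResolventGenerator L G) {C : Set X}
    (hC : IsClosed C) (hinv : ∀ α : ℝ, 0 < α → ∀ f ∈ C, α • G α f ∈ C) {t : ℝ} (ht : 0 < t)
    {f : X} (hf : f ∈ C) : T t f ∈ C := by
  have hpow : ∀ h : ℝ, 0 < h → ∀ (n : ℕ), ∀ u ∈ C, ((h⁻¹ • G h⁻¹) ^ n) u ∈ C := by
    intro h hh n
    induction n with
    | zero => intro u hu; simpa using hu
    | succ n ih =>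
      intro u hu
      rw [pow_succ']
      exact hinv _ (inv_pos.2 hh) _ (ih u hu)
  have hdom : ∀ u ∈ C, ∀ g, (u, g) ∈ L.graph → T t u ∈ C := by
    intro u hu g hg
    refine hC.mem_of_tendsto (tendsto_pow_resolvent hT hL hGr hG ht hg) ?_
    filter_upwards [eventually_gt_atTop 0] with n hn
    exact hpow _ (div_pos ht (by exact_mod_cast hn)) n u hu
  refine hC.mem_of_tendsto (((T t).continuous.tendsto f).comp (hGr.continuous f)) ?_
  filter_upwards [eventually_gt_atTop 0] with α hα
  refine hdom _ (hinv α hα f hf) (α • (α • G α f - f)) ?_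
  exact L.graph.smul_mem α (resolvent_apply_mem_graph hG hα f)

/-- The truncated Laplace transform `∫₀ᴺ e^{-αt} T_t f dt` is a value of the resolvent. -/
theorem integral_exp_semigroup_eq [CompleteSpace X] {L : X →ₗ.[ℝ] X} {G T : ℝ → X →L[ℝ] X}
    (hT : IsC0ContractionSemigroup T) (hL : IsSemigroupGenerator L T)
    (hG : IsResolventGenerator L G) {α N : ℝ} (hα : 0 < α) (hN : 0 ≤ N) (f : X) :
    ∫ t in (0 : ℝ)..N, Real.exp (-α * t) • T (max t 0) f
      = G α (f - Real.exp (-α * N) • T N f) := by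
  set φ : ℝ → X := fun t => Real.exp (-α * t) • T (max t 0) f with hφ
  have hφc : Continuous φ := by
    have := hT.continuous_orbit f
    exact Continuous.smul (by fun_prop) this
  set Φ : ℝ → X := fun x => ∫ t in (0 : ℝ)..x, φ t with hΦ
  have hd : ∀ x, HasDerivAt Φ (φ x) x := fun x => hφc.integral_hasStrictDerivAt 0 x |>.hasDerivAt
  change Φ N = _
  symm
  rw [hG α hα, hL]
  -- `T h (Φ N)` extends to the differentiable function `F h = e^{αh} (Φ (h + N) - Φ h)`.
  set F : ℝ → X := fun h => Real.exp (α * h) • (Φ (h + N) - Φ h) with hF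
  have hF0 : F 0 = Φ N := by simp [hF, hΦ]
  have hTF : ∀ h : ℝ, 0 ≤ h → T h (Φ N) = F h := by
    intro h hh
    have e1 : T h (Φ N) = ∫ t in (0 : ℝ)..N, T h (φ t) :=
      ((T h).intervalIntegral_comp_comm (hφc.intervalIntegrable _ _)).symm
    have e2 : ∫ t in (0 : ℝ)..N, T h (φ t)
        = ∫ t in (0 : ℝ)..N, Real.exp (α * h) • φ (t + h) := by
      refine intervalIntegral.integral_congr fun t ht => ?_
      rw [Set.uIcc_of_le hN] at ht
      have ht0 : 0 ≤ t := ht.1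
      simp only [hφ, map_smul, smul_smul, ← Real.exp_add]
      rw [max_eq_left ht0, max_eq_left (add_nonneg ht0 hh), add_comm t h, hT.add_apply hh ht0]
      congr 2; ring
    rw [e1, e2, intervalIntegral.integral_smul, intervalIntegral.integral_comp_add_right]
    simp only [hF, hΦ]
    rw [intervalIntegral.integral_interval_sub_left (hφc.intervalIntegrable _ _)
      (hφc.intervalIntegrable _ _)]
    simp [add_comm]
  have hFd : HasDerivAt F (α • Φ N - (f - Real.exp (-α * N) • T N f)) 0 := by
    have a1 : HasDerivAt (fun h : ℝ => Real.exp (α * h)) α 0 := by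
      simpa using ((hasDerivAt_id (0 : ℝ)).const_mul α).exp
    have a2 : HasDerivAt (fun h : ℝ => Φ (h + N) - Φ h) (φ N - φ 0) 0 := by
      refine HasDerivAt.sub ?_ (hd 0)
      have : HasDerivAt Φ (φ N) (0 + N) := by simpa using hd N
      exact this.comp_add_const 0 N
    have h0 : φ 0 = f := by simp [hφ, hT.zero]
    have h1 : φ N = Real.exp (-α * N) • T N f := by simp [hφ, hN]
    have h2 : Φ 0 = 0 := by simp [hΦ]
    have h3 : α • Φ N - (f - Real.exp (-α * N) • T N f)
        = Real.exp (α * 0) • (φ N - φ 0) + α • (Φ (0 + N) - Φ 0) := by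
      rw [h0, h1, h2, mul_zero, Real.exp_zero, one_smul, zero_add, sub_zero]
      abel
    rw [h3]
    exact a1.smul a2
  have hs := (hasDerivAt_iff_tendsto_slope.1 hFd).mono_left
    (nhdsWithin_mono 0 (fun x (hx : 0 < x) => hx.ne' : Set.Ioi (0 : ℝ) ⊆ {0}ᶜ))
  refine hs.congr' ?_
  filter_upwards [self_mem_nhdsWithin] with h hh
  have hh : (0 : ℝ) < h := hh
  rw [slope_def_module, hF0, hTF h hh.le, sub_zero]

end Semigroups

/-! ### Sub-Markovian operators on `L²` -/

section Markov

variable {E : Type*} [MeasurableSpace E] {μ : Measure E}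

theorem inner_eq_integral_mul (f g : Lp ℝ 2 μ) : inner ℝ f g = ∫ x, f x * g x ∂μ := by
  rw [L2.inner_def]
  exact integral_congr_ae (Eventually.of_forall fun x => by simp [mul_comm])

theorem integrable_mul_L2 (f g : Lp ℝ 2 μ) : Integrable (fun x => f x * g x) μ :=
  (Lp.memLp f).integrable_mul (Lp.memLp g)

theorem inner_le_inner_of_ae {f g f' g' : Lp ℝ 2 μ}
    (h : ∀ᵐ x ∂μ, f x * g x ≤ f' x * g' x) : inner ℝ f g ≤ inner ℝ f' g' := by
  rw [inner_eq_integral_mul, inner_eq_integral_mul]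
  exact integral_mono_ae (integrable_mul_L2 _ _) (integrable_mul_L2 _ _) h

theorem inner_nonneg_of_ae {f g : Lp ℝ 2 μ} (hf : ∀ᵐ x ∂μ, 0 ≤ f x) (hg : ∀ᵐ x ∂μ, 0 ≤ g x) :
    0 ≤ inner ℝ f g := by
  rw [inner_eq_integral_mul]
  refine integral_nonneg_of_ae ?_
  filter_upwards [hf, hg] with x h1 h2 using mul_nonneg h1 h2

/-- `f` takes values in `[0, 1]` almost everywhere. -/
def IsUnitValued (f : Lp ℝ 2 μ) : Prop := ∀ᵐ x ∂μ, 0 ≤ f x ∧ f x ≤ 1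

theorem isUnitValued_indicator {s : Set E} (hs : MeasurableSet s) (hμs : μ s ≠ ⊤) :
    IsUnitValued (indicatorConstLp 2 hs hμs (1 : ℝ)) := by
  filter_upwards [indicatorConstLp_coeFn (p := 2) (hs := hs) (hμs := hμs) (c := (1 : ℝ))]
    with x hx
  rw [hx]
  by_cases h : x ∈ s <;> simp [h]

theorem inner_indicator_eq (f : Lp ℝ 2 μ) {s : Set E} (hs : MeasurableSet s) (hμs : μ s ≠ ⊤) :
    inner ℝ f (indicatorConstLp 2 hs hμs (1 : ℝ)) = ∫ x in s, f x ∂μ := by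
  rw [real_inner_comm, L2.inner_indicatorConstLp_one]

theorem integrableOn_L2 (f : Lp ℝ 2 μ) {s : Set E} (hμs : μ s ≠ ⊤) : IntegrableOn f s μ :=
  integrableOn_Lp_of_measure_ne_top f (by norm_num) hμs

theorem isUnitValued_of_forall_setIntegral [SigmaFinite μ] {f : Lp ℝ 2 μ}
    (h : ∀ s, MeasurableSet s → μ s ≠ ⊤ →
      0 ≤ ∫ x in s, f x ∂μ ∧ ∫ x in s, f x ∂μ ≤ μ.real s) : IsUnitValued f := by
  have h1 : 0 ≤ᵐ[μ] f := by
    refine ae_nonneg_of_forall_setIntegral_nonneg_of_sigmaFinite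
      (fun s _ hμs => integrableOn_L2 f hμs.ne) fun s hs hμs => (h s hs hμs.ne).1
  have h2 : 0 ≤ᵐ[μ] fun x => 1 - f x := by
    refine ae_nonneg_of_forall_setIntegral_nonneg_of_sigmaFinite
      (fun s _ hμs => (integrableOn_const hμs.ne).sub (integrableOn_L2 f hμs.ne))
      fun s hs hμs => ?_
    have hi : Integrable (fun _ => (1 : ℝ)) (μ.restrict s) := integrableOn_const hμs.ne
    rw [integral_sub hi (integrableOn_L2 f hμs.ne)]
    have := (h s hs hμs.ne).2
    simpa using this
  filter_upwards [h1, h2] with x a b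
  exact ⟨a, by simpa using b⟩

theorem IsSubMarkovian.nonneg {S : Lp ℝ 2 μ →L[ℝ] Lp ℝ 2 μ} (hS : IsSubMarkovian S)
    {f : Lp ℝ 2 μ} (hf : ∀ᵐ x ∂μ, 0 ≤ f x) : ∀ᵐ x ∂μ, 0 ≤ S f x := by
  -- Nonnegative simple functions are bounded, and dense in the nonnegative cone.
  suffices H : ∀ g : {g : Lp ℝ 2 μ // 0 ≤ g}, 0 ≤ S g by
    have h1 := H ⟨f, (Lp.coeFn_nonneg f).1 hf⟩
    exact (Lp.coeFn_nonneg _).2 h1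
  intro g
  refine (Lp.simpleFunc.denseRange_coeSimpleFuncNonnegToLpNonneg 2 μ ℝ
    (by norm_num)).induction_on (p := fun g : {g : Lp ℝ 2 μ // 0 ≤ g} => 0 ≤ S g) g ?_ ?_
  · exact isClosed_le continuous_const (S.continuous.comp continuous_subtype_val)
  · rintro ⟨k, hk⟩
    have hk0 : 0 ≤ (k : Lp ℝ 2 μ) := by exact_mod_cast hk
    change 0 ≤ S (k : Lp ℝ 2 μ)
    obtain ⟨C, hC⟩ := (Lp.simpleFunc.toSimpleFunc k).exists_forall_norm_le
    set D := max C 1 with hD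
    have hD0 : 0 < D := lt_of_lt_of_le one_pos (le_max_right _ _)
    have h1 : ∀ᵐ x ∂μ, 0 ≤ (D⁻¹ • (k : Lp ℝ 2 μ) : Lp ℝ 2 μ) x
        ∧ (D⁻¹ • (k : Lp ℝ 2 μ) : Lp ℝ 2 μ) x ≤ 1 := by
      filter_upwards [Lp.coeFn_smul D⁻¹ (k : Lp ℝ 2 μ), (Lp.coeFn_nonneg _).2 hk0,
        Lp.simpleFunc.toSimpleFunc_eq_toFun k] with x e1 e2 e3
      have e4 : (k : Lp ℝ 2 μ) x ≤ D := by
        rw [← e3]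
        exact (le_abs_self _).trans ((hC x).trans (le_max_left _ _))
      rw [e1, Pi.smul_apply, smul_eq_mul]
      refine ⟨mul_nonneg (inv_nonneg.2 hD0.le) e2, ?_⟩
      rw [inv_mul_le_iff₀ hD0, mul_one]; exact e4
    have h2 := hS _ h1
    rw [map_smul] at h2
    rw [← Lp.coeFn_nonneg]
    filter_upwards [h2, Lp.coeFn_smul D⁻¹ (S (k : Lp ℝ 2 μ))] with x e1 e2
    rw [e2, Pi.smul_apply, smul_eq_mul] at e1
    exact nonneg_of_mul_nonneg_right e1.1 (inv_pos.2 hD0)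

theorem nonneg_of_adjoint_isSubMarkovian [SigmaFinite μ] {S : Lp ℝ 2 μ →L[ℝ] Lp ℝ 2 μ}
    (hS : IsSubMarkovian (ContinuousLinearMap.adjoint S)) {f : Lp ℝ 2 μ}
    (hf : ∀ᵐ x ∂μ, 0 ≤ f x) : ∀ᵐ x ∂μ, 0 ≤ S f x := by
  refine ae_nonneg_of_forall_setIntegral_nonneg_of_sigmaFinite
      (fun s _ hμs => integrableOn_L2 _ hμs.ne) fun s hs hμs => ?_
  rw [← inner_indicator_eq _ hs hμs.ne, ← ContinuousLinearMap.adjoint_inner_right]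
  exact inner_nonneg_of_ae hf ((hS _ (isUnitValued_indicator hs hμs.ne)).mono fun x h => h.1)

/-- The nonnegative elements of `L²` whose integral is at most `c`, described by duality against
`[0, 1]`-valued functions, which makes the set visibly closed in `L²`. -/
def massAtMost (μ : Measure E) (c : ℝ) : Set (Lp ℝ 2 μ) :=
  {f | ∀ h : Lp ℝ 2 μ, IsUnitValued h → 0 ≤ inner ℝ f h ∧ inner ℝ f h ≤ c}

theorem isClosed_massAtMost (c : ℝ) : IsClosed (massAtMost μ c) := by
  have : massAtMost μ c = ⋂ (h : Lp ℝ 2 μ) (_ : IsUnitValued h),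
      {f | 0 ≤ inner ℝ f h} ∩ {f | inner ℝ f h ≤ c} := by
    ext f; simp [massAtMost]
  rw [this]
  refine isClosed_iInter fun h => isClosed_iInter fun _ => IsClosed.inter ?_ ?_
  · exact isClosed_le continuous_const (continuous_id.inner continuous_const)
  · exact isClosed_le (continuous_id.inner continuous_const) continuous_const

theorem nonneg_of_mem_massAtMost [SigmaFinite μ] {c : ℝ} {f : Lp ℝ 2 μ}
    (hf : f ∈ massAtMost μ c) : ∀ᵐ x ∂μ, 0 ≤ f x := by
  refine ae_nonneg_of_forall_setIntegral_nonneg_of_sigmaFinite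
      (fun s _ hμs => integrableOn_L2 f hμs.ne) fun s hs hμs => ?_
  rw [← inner_indicator_eq _ hs hμs.ne]
  exact (hf _ (isUnitValued_indicator hs hμs.ne)).1

theorem mem_massAtMost_of_setIntegral_le [SigmaFinite μ] {c : ℝ} {f : Lp ℝ 2 μ}
    (hf : ∀ᵐ x ∂μ, 0 ≤ f x)
    (h : ∀ s, MeasurableSet s → μ s ≠ ⊤ → ∫ x in s, f x ∂μ ≤ c) : f ∈ massAtMost μ c := by
  intro k hk
  refine ⟨inner_nonneg_of_ae hf (hk.mono fun x h => h.1), ?_⟩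
  have hlim := tendsto_setIntegral_of_monotone (μ := μ) (f := fun x => f x * k x)
    (fun n => measurableSet_spanningSets μ n) (monotone_spanningSets μ)
    (integrable_mul_L2 f k).integrableOn
  rw [iUnion_spanningSets, setIntegral_univ, ← inner_eq_integral_mul] at hlim
  refine le_of_tendsto' hlim fun n => ?_
  have hn := (measure_spanningSets_lt_top μ n).ne
  refine le_trans (setIntegral_mono_ae (integrable_mul_L2 f k).integrableOn
    (integrableOn_L2 f hn) ?_) (h _ (measurableSet_spanningSets μ n) hn)
  filter_upwards [hf, hk] with x h1 h2
  exact mul_le_of_le_one_right h1 h2.2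

theorem indicator_mem_massAtMost {s : Set E} (hs : MeasurableSet s) (hμs : μ s ≠ ⊤) :
    indicatorConstLp 2 hs hμs (1 : ℝ) ∈ massAtMost μ (μ.real s) := by
  intro k hk
  rw [real_inner_comm, inner_indicator_eq]
  refine ⟨integral_nonneg_of_ae (ae_restrict_of_ae (hk.mono fun x h => h.1)), ?_⟩
  have := setIntegral_mono_ae (integrableOn_L2 k hμs) (integrableOn_const hμs (C := (1 : ℝ)))
    (hk.mono fun x h => h.2)
  simpa using this

/-- An operator that does not increase the mass of nonnegative functions has a sub-Markovian
adjoint. -/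
theorem adjoint_isSubMarkovian_of_massAtMost [SigmaFinite μ] {S : Lp ℝ 2 μ →L[ℝ] Lp ℝ 2 μ}
    (hS : ∀ c, ∀ f ∈ massAtMost μ c, S f ∈ massAtMost μ c) :
    IsSubMarkovian (ContinuousLinearMap.adjoint S) := by
  intro h hh
  refine isUnitValued_of_forall_setIntegral fun s hs hμs => ?_
  rw [← inner_indicator_eq _ hs hμs, ContinuousLinearMap.adjoint_inner_left, real_inner_comm]
  exact hS _ _ (indicator_mem_massAtMost hs hμs) h hh

/-! ### Unit contractions and the resolvents of Dirichlet forms -/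

/-- `w` is the unit contraction `u⁺ ∧ 1` of `u`. -/
def IsUnitContraction (u w : Lp ℝ 2 μ) : Prop := w =ᵐ[μ] fun x => min (max (u x) 0) 1

theorem IsUnitContraction.isUnitValued {u w : Lp ℝ 2 μ} (h : IsUnitContraction u w) :
    IsUnitValued w := by
  filter_upwards [h] with x hx
  rw [hx]
  exact ⟨le_min (le_max_right _ _) zero_le_one, min_le_right _ _⟩

theorem IsUnitContraction.norm_sub_le {u w u' w' : Lp ℝ 2 μ} (h : IsUnitContraction u w)
    (h' : IsUnitContraction u' w') : ‖w - w'‖ ≤ ‖u - u'‖ := by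
  refine Lp.norm_le_norm_of_ae_le ?_
  filter_upwards [h, h', Lp.coeFn_sub w w', Lp.coeFn_sub u u'] with x h1 h2 h3 h4
  rw [h3, h4, Pi.sub_apply, Pi.sub_apply, h1, h2, Real.norm_eq_abs, Real.norm_eq_abs]
  grind

theorem IsUnitContraction.norm_le {u w : Lp ℝ 2 μ} (h : IsUnitContraction u w) : ‖w‖ ≤ ‖u‖ := by
  have h0 : IsUnitContraction (0 : Lp ℝ 2 μ) (0 : Lp ℝ 2 μ) := by
    filter_upwards [Lp.coeFn_zero ℝ 2 μ] with x hx
    have hx : (0 : Lp ℝ 2 μ) x = 0 := hx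
    rw [hx, max_self, min_eq_left zero_le_one]
  simpa using h.norm_sub_le h0

/-- The inequality `(u - w)² ≤ (u - f) (u - w)`, for `w = u⁺ ∧ 1` and `0 ≤ f ≤ 1`, holds
pointwise. -/
theorem isUnitValued_of_inner_sub_nonpos {f u w : Lp ℝ 2 μ} (hf : IsUnitValued f)
    (hw : IsUnitContraction u w) (h : inner ℝ (u - f) (u - w) ≤ 0) : IsUnitValued u := by
  have h1 : inner ℝ (u - w) (u - w) ≤ inner ℝ (u - f) (u - w) := by
    refine inner_le_inner_of_ae ?_
    filter_upwards [hf, hw, Lp.coeFn_sub u w, Lp.coeFn_sub u f] with x h1 h2 h3 h4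
    rw [h3, h4, Pi.sub_apply, Pi.sub_apply, h2]
    rcases le_total (u x) 0 with h5 | h5
    · rw [max_eq_right h5, min_eq_left zero_le_one]; nlinarith
    · rw [max_eq_left h5]
      rcases le_total (u x) 1 with h6 | h6
      · rw [min_eq_left h6]; simp
      · rw [min_eq_right h6]; nlinarith
  have h2 : inner ℝ (u - w) (u - w) = 0 := le_antisymm (h1.trans h) real_inner_self_nonneg
  rw [inner_self_eq_zero, sub_eq_zero] at h2
  rw [h2]
  exact hw.isUnitValued

/-- A sub-Markovian contraction satisfies `(S u, u - w) ≤ (u, u - w)` for `w = u⁺ ∧ 1`. -/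
theorem IsSubMarkovian.inner_le {S : Lp ℝ 2 μ →L[ℝ] Lp ℝ 2 μ} (hS : IsSubMarkovian S)
    (hS1 : ‖S‖ ≤ 1) {u w : Lp ℝ 2 μ} (hw : IsUnitContraction u w) :
    inner ℝ (S u) (u - w) ≤ inner ℝ u (u - w) := by
  have h1 : inner ℝ (S (u - w)) (u - w) ≤ inner ℝ (u - w) (u - w) := by
    refine (real_inner_le_norm _ _).trans ?_
    rw [real_inner_self_eq_norm_mul_norm]
    refine mul_le_mul_of_nonneg_right ?_ (norm_nonneg _)
    simpa using S.le_of_opNorm_le hS1 (u - w)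
  have h2 : inner ℝ (S w) (u - w) ≤ inner ℝ w (u - w) := by
    refine inner_le_inner_of_ae ?_
    filter_upwards [hS w hw.isUnitValued, hw, Lp.coeFn_sub u w] with x h1 h2 h3
    rw [h3, Pi.sub_apply, h2]
    rcases le_total (u x) 0 with h5 | h5
    · rw [max_eq_right h5, min_eq_left zero_le_one]; nlinarith
    · rw [max_eq_left h5]
      rcases le_total (u x) 1 with h6 | h6
      · rw [min_eq_left h6]; simp
      · rw [min_eq_right h6]; nlinarith
  have h3 : inner ℝ (S u) (u - w) = inner ℝ (S (u - w)) (u - w) + inner ℝ (S w) (u - w) := by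
    rw [← inner_add_left, ← map_add, sub_add_cancel]
  have h4 : inner ℝ u (u - w) = inner ℝ (u - w) (u - w) + inner ℝ w (u - w) := by
    rw [← inner_add_left, sub_add_cancel]
  linarith

theorem generator_inner_nonpos {Λ : Lp ℝ 2 μ →ₗ.[ℝ] Lp ℝ 2 μ}
    {U : ℝ → Lp ℝ 2 μ →L[ℝ] Lp ℝ 2 μ} (hU : IsC0ContractionSemigroup U)
    (hΛ : IsSemigroupGenerator Λ U) (hsub : ∀ t : ℝ, 0 < t → IsSubMarkovian (U t))
    {u f w : Lp ℝ 2 μ} (hu : (u, f) ∈ Λ.graph) (hw : IsUnitContraction u w) :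
    inner ℝ f (u - w) ≤ 0 := by
  refine le_of_tendsto (((hΛ u f).1 hu).inner (tendsto_const_nhds (x := u - w))) ?_
  filter_upwards [self_mem_nhdsWithin] with t ht
  have ht : (0 : ℝ) < t := ht
  rw [real_inner_smul_left, inner_sub_left]
  exact mul_nonpos_of_nonneg_of_nonpos (inv_pos.2 ht).le
    (sub_nonpos.2 ((hsub t ht).inner_le (hU.contraction t ht.le) hw))

section Forms

variable {B : PartialForm (Lp ℝ 2 μ)}

theorem IsDirichletForm.exists_unitContraction (hB : IsDirichletForm B) (u : B.dom) :
    ∃ w : B.dom, IsUnitContraction (u : Lp ℝ 2 μ) w ∧ 0 ≤ B.form (u + w) (u - w) ∧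
      0 ≤ B.form (u - w) (u + w) := hB.unitContraction u

theorem IsUnitContraction.unique {u w w' : Lp ℝ 2 μ} (h : IsUnitContraction u w)
    (h' : IsUnitContraction u w') : w = w' := Lp.ext (h.trans h'.symm)

theorem IsDirichletForm.form_inequalities (hB : IsDirichletForm B) {u w : B.dom}
    (h : IsUnitContraction (u : Lp ℝ 2 μ) w) :
    0 ≤ B.form (u + w) (u - w) ∧ 0 ≤ B.form (u - w) (u + w) := by
  obtain ⟨w', h1, h2⟩ := hB.exists_unitContraction u
  obtain rfl : w = w' := Subtype.ext (h.unique h1)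
  exact h2

theorem IsDirichletForm.form_self_sub_nonneg (hB : IsDirichletForm B) {u w : B.dom}
    (h : IsUnitContraction (u : Lp ℝ 2 μ) w) : 0 ≤ B.form u (u - w) := by
  have h1 := (hB.form_inequalities h).1
  have h2 := hB.nonneg (u - w)
  have h3 : B.form (u + w) (u - w) + B.form (u - w) (u - w) = 2 * B.form u (u - w) := by
    rw [← LinearMap.add_apply, ← map_add, add_add_sub_cancel, ← two_smul ℝ u, map_smul]
    rfl
  linarith

theorem IsDirichletForm.form_unitContraction_le (hB : IsDirichletForm B) {u w : B.dom}
    (h : IsUnitContraction (u : Lp ℝ 2 μ) w) : B.form w w ≤ B.form u u := by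
  obtain ⟨h1, h2⟩ := hB.form_inequalities h
  simp only [map_add, map_sub, LinearMap.add_apply, LinearMap.sub_apply] at h1 h2
  linarith

/-- The unit contraction of `w + a (u - w)` is still `w = u⁺ ∧ 1`, for every `a > 0`; the
contraction inequality for small `a` is linear in `u - w` to first order. -/
theorem IsDirichletForm.form_unitContraction_nonneg (hB : IsDirichletForm B) {u w : B.dom}
    (h : IsUnitContraction (u : Lp ℝ 2 μ) w) : 0 ≤ B.form u w := by
  have key : ∀ a : ℝ, 0 < a → 0 ≤ 2 * B.form (u - w) w + a * B.form (u - w) (u - w) := by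
    intro a ha
    have hz : IsUnitContraction ((w + a • (u - w) : B.dom) : Lp ℝ 2 μ) w := by
      filter_upwards [h, Lp.coeFn_add (w : Lp ℝ 2 μ) (a • (u - w : Lp ℝ 2 μ)),
        Lp.coeFn_smul a (u - w : Lp ℝ 2 μ), Lp.coeFn_sub (u : Lp ℝ 2 μ) (w : Lp ℝ 2 μ)]
        with x h1 h2 h3 h4
      have e : ((w + a • (u - w) : B.dom) : Lp ℝ 2 μ) x
          = (w : Lp ℝ 2 μ) x + a * ((u : Lp ℝ 2 μ) x - (w : Lp ℝ 2 μ) x) := by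
        change ((w : Lp ℝ 2 μ) + a • (u - w : Lp ℝ 2 μ) : Lp ℝ 2 μ) x = _
        rw [h2, Pi.add_apply, h3, Pi.smul_apply, h4, Pi.sub_apply, smul_eq_mul]
      rw [e, h1]
      rcases le_total ((u : Lp ℝ 2 μ) x) 0 with h5 | h5
      · rw [max_eq_right h5, min_eq_left zero_le_one, max_eq_right, min_eq_left zero_le_one]
        nlinarith
      · rw [max_eq_left h5]
        rcases le_total ((u : Lp ℝ 2 μ) x) 1 with h6 | h6
        · rw [min_eq_left h6]; simp [h5, h6]
        · rw [min_eq_right h6, min_eq_right]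
          exact le_max_of_le_left (by nlinarith)
    have h1 := (hB.form_inequalities hz).2
    have e1 : w + a • (u - w) - w = a • (u - w) := by abel
    rw [e1] at h1
    simp only [map_add, map_smul, LinearMap.smul_apply, smul_eq_mul] at h1
    have h2 : 0 ≤ a * (2 * B.form (u - w) w + a * B.form (u - w) (u - w)) := by linarith
    exact nonneg_of_mul_nonneg_right h2 ha
  have h1 : 0 ≤ 2 * B.form (u - w) w := by
    have hc : Tendsto (fun a : ℝ => 2 * B.form (u - w) w + a * B.form (u - w) (u - w)) (𝓝[>] 0)
        (𝓝 (2 * B.form (u - w) w + 0 * B.form (u - w) (u - w))) :=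
      (Continuous.tendsto (by fun_prop) 0).mono_left nhdsWithin_le_nhds
    rw [zero_mul, add_zero] at hc
    exact ge_of_tendsto hc (by filter_upwards [self_mem_nhdsWithin] with a ha using key a ha)
  have h2 := hB.nonneg w
  rw [map_sub, LinearMap.sub_apply] at h1
  linarith

theorem IsFormResolvent.isSubMarkovian (hB : IsDirichletForm B)
    {G : ℝ → Lp ℝ 2 μ →L[ℝ] Lp ℝ 2 μ} (hG : IsFormResolvent B G) {α : ℝ} (hα : 0 < α) :
    IsSubMarkovian (α • G α) := by
  intro f hf
  obtain ⟨u, hu, hform⟩ := hG.2 α hα (α • f)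
  obtain ⟨w, hw, -⟩ := hB.exists_unitContraction u
  have e : (α • G α) f = u := by rw [hu, map_smul]; rfl
  rw [e]
  refine isUnitValued_of_inner_sub_nonpos hf hw ?_
  have h1 := hform (u - w)
  have h2 := hB.form_self_sub_nonneg hw
  rw [real_inner_smul_left, Submodule.coe_sub] at h1
  rw [inner_sub_left]
  nlinarith

theorem IsFormResolvent.smul_apply_mem_massAtMost [SigmaFinite μ] (hB : IsDirichletForm B)
    {G : ℝ → Lp ℝ 2 μ →L[ℝ] Lp ℝ 2 μ} (hG : IsFormResolvent B G) {α : ℝ} (hα : 0 < α) {c : ℝ}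
    {f : Lp ℝ 2 μ} (hf : f ∈ massAtMost μ c) : α • G α f ∈ massAtMost μ c := by
  obtain ⟨u, hu, hform⟩ := hG.2 α hα (α • f)
  have e : α • G α f = u := by rw [hu, map_smul]
  have hpos : ∀ᵐ x ∂μ, 0 ≤ (u : Lp ℝ 2 μ) x := by
    rw [← e]
    exact (IsFormResolvent.isSubMarkovian hB hG hα).nonneg (nonneg_of_mem_massAtMost hf)
  rw [e]
  refine mem_massAtMost_of_setIntegral_le hpos fun s hs hμs => ?_
  -- Testing with `(n u) ∧ 1`, which increases to the indicator of `{u > 0}`.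
  have key : ∀ n : ℕ, ∫ x in s, (u : Lp ℝ 2 μ) x ∂μ ≤ c + 1 / ((n : ℝ) + 1) * μ.real s := by
    intro n
    set m : ℝ := n + 1 with hm
    have hm0 : 0 < m := by positivity
    obtain ⟨w, hw, -⟩ := hB.exists_unitContraction (m • u)
    have h1 := hB.form_unitContraction_nonneg hw
    rw [map_smul, LinearMap.smul_apply, smul_eq_mul] at h1
    have h1 := nonneg_of_mul_nonneg_right h1 hm0
    have h2 := hform w
    rw [real_inner_smul_left] at h2
    have h3 := (hf w hw.isUnitValued).2
    have h4 : inner ℝ (u : Lp ℝ 2 μ) (w : Lp ℝ 2 μ) ≤ c := by nlinarith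
    have h5 : ∫ x in s, (u : Lp ℝ 2 μ) x ∂μ ≤ ∫ x, ((u : Lp ℝ 2 μ) x * (w : Lp ℝ 2 μ) x
        + s.indicator (fun _ => 1 / m) x) ∂μ := by
      rw [← integral_indicator hs]
      refine integral_mono_ae ((integrable_indicator_iff hs).2 (integrableOn_L2 _ hμs))
        ((integrable_mul_L2 _ _).add ((integrable_indicator_iff hs).2 (integrableOn_const hμs)))
        ?_
      filter_upwards [hpos, hw, Lp.coeFn_smul m (u : Lp ℝ 2 μ)] with x a1 a2 a3
      have a4 : ((m • u : B.dom) : Lp ℝ 2 μ) x = m * (u : Lp ℝ 2 μ) x := a3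
      rw [a2, a4, max_eq_left (mul_nonneg hm0.le a1)]
      have a5 : 0 ≤ min (m * (u : Lp ℝ 2 μ) x) 1 := le_min (mul_nonneg hm0.le a1) zero_le_one
      by_cases hx : x ∈ s
      · simp only [Set.indicator_of_mem hx]
        rcases le_total (m * (u : Lp ℝ 2 μ) x) 1 with h6 | h6
        · have : (u : Lp ℝ 2 μ) x ≤ 1 / m := by rw [le_div_iff₀ hm0]; linarith
          have := mul_nonneg a1 a5
          linarith
        · rw [min_eq_right h6, mul_one]
          have : 0 < 1 / m := by positivity
          linarith
      · simp only [Set.indicator_of_notMem hx, add_zero]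
        exact mul_nonneg a1 a5
    rw [integral_add (integrable_mul_L2 _ _)
      ((integrable_indicator_iff hs).2 (integrableOn_const hμs)), ← inner_eq_integral_mul,
      integral_indicator hs, setIntegral_const, smul_eq_mul] at h5
    linarith
  have hlim : Tendsto (fun n : ℕ => c + 1 / ((n : ℝ) + 1) * μ.real s) atTop
      (𝓝 (c + 0 * μ.real s)) :=
    (tendsto_one_div_add_atTop_nhds_zero_nat.mul_const _).const_add _
  rw [zero_mul, add_zero] at hlim
  exact ge_of_tendsto' hlim key

/-- The invariance of the sets `massAtMost μ c` passes from the resolvent to the semigroup. -/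
theorem IsFormSemigroup.adjoint_isSubMarkovian [SigmaFinite μ] (hB : IsDirichletForm B)
    {T : ℝ → Lp ℝ 2 μ →L[ℝ] Lp ℝ 2 μ} (hT : IsFormSemigroup B T) {t : ℝ} (ht : 0 < t) :
    IsSubMarkovian (ContinuousLinearMap.adjoint (T t)) := by
  obtain ⟨hT0, G, L, hG, hLG, hLT⟩ := hT
  refine adjoint_isSubMarkovian_of_massAtMost fun c f hf => ?_
  exact semigroup_apply_mem_of_resolvent hT0 hLT hG.1 hLG (isClosed_massAtMost c)
    (fun α hα f hf => IsFormResolvent.smul_apply_mem_massAtMost hB hG hα hf) ht hf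

end Forms

end Markov

/-! ### The resolvent of a generalized Dirichlet form -/

section NormOne

variable {H : Type*} [NormedAddCommGroup H] [InnerProductSpace ℝ H] {B : PartialForm H}

theorem norm1_nonneg (u : B.dom) : 0 ≤ B.norm1 u := Real.sqrt_nonneg _

theorem norm1_sq (hB : ∀ u : B.dom, 0 ≤ B.form u u) (u : B.dom) :
    B.norm1 u ^ 2 = B.form u u + ‖(u : H)‖ ^ 2 :=
  Real.sq_sqrt (add_nonneg (hB u) (sq_nonneg _))

theorem norm_le_norm1 (hB : ∀ u : B.dom, 0 ≤ B.form u u) (u : B.dom) :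
    ‖(u : H)‖ ≤ B.norm1 u :=
  Real.le_sqrt_of_sq_le (le_add_of_nonneg_left (hB u))

/-- A triangle inequality with a non-optimal constant, from the parallelogram identity. -/
theorem norm1_sub_le (hB : ∀ u : B.dom, 0 ≤ B.form u u) (u v : B.dom) :
    B.norm1 (u - v) ≤ 2 * (B.norm1 u + B.norm1 v) := by
  have hu := norm1_sq hB u
  have hv := norm1_sq hB v
  have h1 := norm1_sq hB (u - v)
  have h2 := norm1_sq hB (u + v)
  have h3 := parallelogram_law_with_norm ℝ (u : H) (v : H)
  have h4 : B.norm1 (u - v) ^ 2 + B.norm1 (u + v) ^ 2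
      = 2 * B.norm1 u ^ 2 + 2 * B.norm1 v ^ 2 := by
    rw [h1, h2, hu, hv]
    simp only [map_add, map_sub, LinearMap.add_apply, LinearMap.sub_apply, Submodule.coe_add,
      Submodule.coe_sub]
    linarith
  have n1 := norm1_nonneg u
  have n2 := norm1_nonneg v
  refine le_of_sq_le_sq ?_ (by positivity)
  nlinarith [sq_nonneg (B.norm1 (u + v)), mul_nonneg n1 n2]

end NormOne

section GenForm

variable {E : Type*} [MeasurableSpace E] {μ : Measure E}

theorem IsDirichletForm.norm1_unitContraction_le {B : PartialForm (Lp ℝ 2 μ)}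
    (hB : IsDirichletForm B) {u w : B.dom} (h : IsUnitContraction (u : Lp ℝ 2 μ) w) :
    B.norm1 w ≤ B.norm1 u := by
  refine Real.sqrt_le_sqrt (add_le_add (hB.form_unitContraction_le h) ?_)
  have h1 := h.norm_le
  gcongr

/-- The inequality `⟨Λ u, u - u⁺ ∧ 1⟩ ≤ 0` passes to the closure of `Λ`. For `wₙ → u` in the graph
norm the functions `wₙ - wₙ⁺ ∧ 1` stay bounded in `V` and converge in `H`; a functional that is a
limit in `V'` of elements of `H` converges along such a sequence. -/
theorem InClosureGraph.apply_sub_nonpos {A : PartialForm (Lp ℝ 2 μ)} (hA : IsDirichletForm A)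
    {Λ : Lp ℝ 2 μ →ₗ.[ℝ] Lp ℝ 2 μ} {U : ℝ → Lp ℝ 2 μ →L[ℝ] Lp ℝ 2 μ}
    (hU : IsC0ContractionSemigroup U) (hΛ : IsSemigroupGenerator Λ U)
    (hsub : ∀ t : ℝ, 0 < t → IsSubMarkovian (U t)) {u p : A.dom} {ℓ : A.dom →ₗ[ℝ] ℝ}
    (h : InClosureGraph A Λ u ℓ) (hp : IsUnitContraction (u : Lp ℝ 2 μ) p) : ℓ (u - p) ≤ 0 := by
  obtain ⟨w, f, hgraph, hw, hℓ⟩ := h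
  choose q hq using fun n => hA.exists_unitContraction (w n)
  have hq : ∀ n, IsUnitContraction (w n : Lp ℝ 2 μ) (q n) := fun n => (hq n).1
  set z : ℕ → A.dom := fun n => w n - q n with hz
  set D : ℝ := 2 * (1 + A.norm1 u) with hD
  have hu0 := norm1_nonneg u
  have hsub4 : ∀ v r : A.dom, IsUnitContraction (v : Lp ℝ 2 μ) r →
      A.norm1 (v - r) ≤ 4 * A.norm1 v := by
    intro v r hr
    have h1 := norm1_sub_le hA.nonneg v r
    have h2 := hA.norm1_unitContraction_le hr
    linarith
  have hbound : ∀ᶠ n in atTop, A.norm1 (w n) ≤ D := by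
    filter_upwards [hw.eventually (ge_mem_nhds (zero_lt_one))] with n hn
    have h1 := norm1_sub_le hA.nonneg (w n - u) (-u)
    have h2 : A.norm1 (-u) = A.norm1 u := by simp [PartialForm.norm1]
    rw [sub_neg_eq_add, sub_add_cancel, h2] at h1
    linarith
  have hzu : Tendsto (fun n => (u - p : Lp ℝ 2 μ) - (z n : Lp ℝ 2 μ)) atTop (𝓝 0) := by
    rw [tendsto_zero_iff_norm_tendsto_zero]
    refine squeeze_zero (fun _ => norm_nonneg _) (fun n => ?_) (by simpa using hw.const_mul 2)
    have e : (u - p : Lp ℝ 2 μ) - (z n : Lp ℝ 2 μ)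
        = (q n - p : Lp ℝ 2 μ) - (w n - u : Lp ℝ 2 μ) := by
      simp only [hz, Submodule.coe_sub]; abel
    rw [e]
    have h1 := norm_sub_le (q n - p : Lp ℝ 2 μ) (w n - u : Lp ℝ 2 μ)
    have h2 := (hq n).norm_sub_le hp
    have h3 := norm_le_norm1 hA.nonneg (w n - u)
    rw [Submodule.coe_sub] at h3
    linarith
  have key : ∀ ε : ℝ, 0 < ε → ℓ (u - p) ≤ ε * (20 * D) := by
    intro ε hε
    obtain ⟨m, hm⟩ := (hℓ ε hε).exists
    have hlim : Tendsto (fun n => inner ℝ (f m) ((u - p : Lp ℝ 2 μ) - (z n : Lp ℝ 2 μ))) atTop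
        (𝓝 0) := by
      simpa using (tendsto_const_nhds (x := f m)).inner hzu
    have hlim2 : Tendsto (fun n => ε * (20 * D)
        + inner ℝ (f m) ((u - p : Lp ℝ 2 μ) - (z n : Lp ℝ 2 μ))) atTop (𝓝 (ε * (20 * D))) := by
      simpa using hlim.const_add (ε * (20 * D))
    refine ge_of_tendsto hlim2 ?_
    filter_upwards [hbound, hℓ ε hε] with n hn1 hn2
    have a1 := hsub4 u p hp
    have a2 := hsub4 (w n) (q n) (hq n)
    have a3 := norm1_sub_le hA.nonneg (u - p) (z n)
    have a4 := (abs_le.1 (hm (u - p - z n))).1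
    have a5 := (abs_le.1 (hn2 (z n))).1
    have a6 := generator_inner_nonpos hU hΛ hsub (hgraph n) (hq n)
    have a7 : ℓ (u - p - z n) = ℓ (u - p) - ℓ (z n) := map_sub _ _ _
    have a8 : inner ℝ (f n) (z n : Lp ℝ 2 μ) ≤ 0 := a6
    have a9 : A.norm1 (z n) ≤ 4 * D := a2.trans (by linarith)
    have a10 : A.norm1 (u - p - z n) ≤ 16 * D := by linarith
    have a11 := mul_le_mul_of_nonneg_left a9 hε.le
    have a12 := mul_le_mul_of_nonneg_left a10 hε.le
    have a13 : ((u - p - z n : A.dom) : Lp ℝ 2 μ) = (u - p : Lp ℝ 2 μ) - (z n : Lp ℝ 2 μ) := rfl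
    rw [a7, a13] at a4
    linarith
  have hlim : Tendsto (fun ε : ℝ => ε * (20 * D)) (𝓝[>] 0) (𝓝 (0 * (20 * D))) :=
    (Continuous.tendsto (by fun_prop) 0).mono_left nhdsWithin_le_nhds
  rw [zero_mul] at hlim
  exact ge_of_tendsto hlim (by filter_upwards [self_mem_nhdsWithin] with ε hε using key ε hε)

theorem closureMap_spec {A : PartialForm (Lp ℝ 2 μ)} {Λ : Lp ℝ 2 μ →ₗ.[ℝ] Lp ℝ 2 μ} {u : A.dom}
    (hu : u ∈ closureDomain A Λ) : InClosureGraph A Λ u (closureMap A Λ u) := by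
  have h : ∃ ℓ, InClosureGraph A Λ u ℓ := hu
  rw [closureMap, dif_pos h]
  exact h.choose_spec

theorem IsGenFormResolvent.isSubMarkovian {A : PartialForm (Lp ℝ 2 μ)} (hA : IsDirichletForm A)
    {Λ : Lp ℝ 2 μ →ₗ.[ℝ] Lp ℝ 2 μ} {U : ℝ → Lp ℝ 2 μ →L[ℝ] Lp ℝ 2 μ}
    (hU : IsC0ContractionSemigroup U) (hΛ : IsSemigroupGenerator Λ U)
    (hsub : ∀ t : ℝ, 0 < t → IsSubMarkovian (U t)) {G : ℝ → Lp ℝ 2 μ →L[ℝ] Lp ℝ 2 μ}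
    (hG : IsGenFormResolvent A Λ G) {α : ℝ} (hα : 0 < α) : IsSubMarkovian (α • G α) := by
  intro f hf
  obtain ⟨u, huF, hu, hform⟩ := hG.2 α hα (α • f)
  obtain ⟨p, hp, -⟩ := hA.exists_unitContraction u
  have e : (α • G α) f = u := by rw [hu, map_smul]; rfl
  rw [e]
  refine isUnitValued_of_inner_sub_nonpos hf hp ?_
  have h1 := hform (u - p)
  have h2 := hA.form_self_sub_nonneg hp
  have h3 := (closureMap_spec huF).apply_sub_nonpos hA hU hΛ hsub hp
  rw [real_inner_smul_left, Submodule.coe_sub, genForm] at h1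
  rw [inner_sub_left]
  nlinarith

end GenForm

/-! ### The extension of the semigroup to `L¹` -/

section L1

variable {E : Type*} [MeasurableSpace E] {μ : Measure E}

/-- An operator with a sub-Markovian adjoint is a contraction for the `L¹`-norm, here
stated on a set of finite measure. The test function
`1_{s ∩ {S f ≥ 0}} - 1_{s ∩ {S f < 0}}` is a difference of two `[0, 1]`-valued functions, hence so
is its image under the adjoint. -/
theorem setIntegral_norm_le_of_adjoint_isSubMarkovian {S : Lp ℝ 2 μ →L[ℝ] Lp ℝ 2 μ}
    (hS : IsSubMarkovian (ContinuousLinearMap.adjoint S)) {f : Lp ℝ 2 μ} (hf : Integrable f μ)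
    {s : Set E} (hs : MeasurableSet s) (hμs : μ s ≠ ⊤) :
    ∫ x in s, ‖S f x‖ ∂μ ≤ ∫ x, ‖f x‖ ∂μ := by
  have hmeas : MeasurableSet {x | 0 ≤ S f x} :=
    measurableSet_le measurable_const (Lp.stronglyMeasurable (S f)).measurable
  have hP : MeasurableSet (s ∩ {x | 0 ≤ S f x}) := hs.inter hmeas
  have hQ : MeasurableSet (s \ {x | 0 ≤ S f x}) := hs.diff hmeas
  have hμP : μ (s ∩ {x | 0 ≤ S f x}) ≠ ⊤ := measure_ne_top_of_subset Set.inter_subset_left hμs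
  have hμQ : μ (s \ {x | 0 ≤ S f x}) ≠ ⊤ := measure_ne_top_of_subset Set.sdiff_subset hμs
  set a := indicatorConstLp 2 hP hμP (1 : ℝ)
  set b := indicatorConstLp 2 hQ hμQ (1 : ℝ)
  have h1 : ∫ x in s, ‖S f x‖ ∂μ = inner ℝ (S f) a - inner ℝ (S f) b := by
    rw [inner_indicator_eq, inner_indicator_eq, ← integral_inter_add_sdiff hmeas
      (integrableOn_L2 (S f) hμs).norm, sub_eq_add_neg, ← integral_neg]
    congr 1
    · exact setIntegral_congr_fun hP fun x hx => by
        simpa using hx.2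
    · refine setIntegral_congr_fun hQ fun x hx => ?_
      have : S f x < 0 := not_le.1 hx.2
      simp [abs_of_neg this]
  rw [h1, ← ContinuousLinearMap.adjoint_inner_right, ← ContinuousLinearMap.adjoint_inner_right,
    ← inner_sub_right, inner_eq_integral_mul]
  refine integral_mono_ae (integrable_mul_L2 _ _) hf.norm ?_
  filter_upwards [hS a (isUnitValued_indicator hP hμP), hS b (isUnitValued_indicator hQ hμQ),
    Lp.coeFn_sub (ContinuousLinearMap.adjoint S a) (ContinuousLinearMap.adjoint S b)]
    with x h1 h2 h3
  rw [h3, Pi.sub_apply]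
  refine (le_abs_self _).trans ?_
  rw [abs_mul, Real.norm_eq_abs]
  refine mul_le_of_le_one_right (abs_nonneg _) (abs_le.2 ⟨?_, ?_⟩) <;>
    linarith [h1.1, h1.2, h2.1, h2.2]

theorem integral_norm_le_of_adjoint_isSubMarkovian [SigmaFinite μ]
    {S : Lp ℝ 2 μ →L[ℝ] Lp ℝ 2 μ}
    (hS : IsSubMarkovian (ContinuousLinearMap.adjoint S)) {f : Lp ℝ 2 μ} (hf : Integrable f μ) :
    Integrable (S f) μ ∧ ∫ x, ‖S f x‖ ∂μ ≤ ∫ x, ‖f x‖ ∂μ := by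
  have h : ∀ s, MeasurableSet s → μ s ≠ ⊤ →
      ∫⁻ x in s, ‖S f x‖ₑ ∂μ ≤ ENNReal.ofReal (∫ x, ‖f x‖ ∂μ) := by
    intro s hs hμs
    rw [← ofReal_integral_norm_eq_lintegral_enorm (integrableOn_L2 (S f) hμs)]
    exact ENNReal.ofReal_le_ofReal
      (setIntegral_norm_le_of_adjoint_isSubMarkovian hS hf hs hμs)
  have hi : Integrable (S f) μ := integrable_of_forall_fin_meas_le _ ENNReal.ofReal_lt_top
    (Lp.aestronglyMeasurable _) h
  refine ⟨hi, ?_⟩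
  have h2 := lintegral_le_of_forall_fin_meas_le _ h
  rw [← ofReal_integral_norm_eq_lintegral_enorm hi] at h2
  exact (ENNReal.ofReal_le_ofReal_iff (integral_nonneg fun x => norm_nonneg _)).1 h2

/-- The operators `T` on `L²` and `S` on `L¹` agree on `L¹ ∩ L²`. -/
def AgreeOnL1L2 (T : Lp ℝ 2 μ →L[ℝ] Lp ℝ 2 μ) (S : Lp ℝ 1 μ →L[ℝ] Lp ℝ 1 μ) : Prop :=
  ∀ (f : Lp ℝ 2 μ) (g : Lp ℝ 1 μ), f =ᵐ[μ] g → T f =ᵐ[μ] S g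

/-- Every simple function in `L¹` lies in `L²` and vanishes outside of a set of finite measure. -/
theorem simpleFunc_exists_L2 (k : Lp.simpleFunc ℝ 1 μ) :
    ∃ f : Lp ℝ 2 μ, f =ᵐ[μ] (k : Lp ℝ 1 μ) ∧
      ∃ s, MeasurableSet s ∧ μ s ≠ ⊤ ∧ ∀ᵐ x ∂μ, x ∉ s → f x = 0 := by
  have h1 : (Lp.simpleFunc.toSimpleFunc k).FinMeasSupp μ :=
    (SimpleFunc.memLp_iff_finMeasSupp one_ne_zero ENNReal.one_ne_top).1 (Lp.simpleFunc.memLp k)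
  have h2 : MemLp (Lp.simpleFunc.toSimpleFunc k) 2 μ :=
    (SimpleFunc.memLp_iff_finMeasSupp two_ne_zero ENNReal.ofNat_ne_top).2 h1
  refine ⟨h2.toLp _, h2.coeFn_toLp.trans (Lp.simpleFunc.toSimpleFunc_eq_toFun k),
    Function.support (Lp.simpleFunc.toSimpleFunc k), SimpleFunc.measurableSet_support _,
    (SimpleFunc.finMeasSupp_iff_support.1 h1).ne, ?_⟩
  filter_upwards [h2.coeFn_toLp] with x hx hxs
  rw [hx]
  exact Function.notMem_support.1 hxs

/-- A closed property that holds for integrable functions in `L²` holds on all of `L¹`. -/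
theorem L1_induction {P : Lp ℝ 1 μ → Prop} (hc : IsClosed {g | P g})
    (h : ∀ (g : Lp ℝ 1 μ) (f : Lp ℝ 2 μ), f =ᵐ[μ] g → P g) (g : Lp ℝ 1 μ) : P g :=
  (Lp.simpleFunc.denseRange ENNReal.one_ne_top).induction_on g hc fun k => by
    obtain ⟨f, hf, -⟩ := simpleFunc_exists_L2 k
    exact h _ f hf

theorem exists_agreeOnL1L2 {T : Lp ℝ 2 μ →L[ℝ] Lp ℝ 2 μ}
    (hT : ∀ f : Lp ℝ 2 μ, Integrable f μ →
      Integrable (T f) μ ∧ ∫ x, ‖T f x‖ ∂μ ≤ ∫ x, ‖f x‖ ∂μ) :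
    ∃ S : Lp ℝ 1 μ →L[ℝ] Lp ℝ 1 μ, ‖S‖ ≤ 1 ∧ AgreeOnL1L2 T S := by
  set D : Submodule ℝ (Lp ℝ 1 μ) :=
    { carrier := {g | MemLp g 2 μ}
      add_mem' := fun {a b} ha hb => (MemLp.add ha hb).ae_eq (Lp.coeFn_add a b).symm
      zero_mem' := (MemLp.zero (p := 2) (μ := μ) (ε := ℝ)).ae_eq (Lp.coeFn_zero ℝ 1 μ).symm
      smul_mem' := fun c a ha => (MemLp.const_smul ha c).ae_eq (Lp.coeFn_smul c a).symm }
    with hD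
  have hmem : ∀ g : D, MemLp (g : Lp ℝ 1 μ) 2 μ := fun g => g.2
  have hint : ∀ g : D, Integrable ((hmem g).toLp _ : Lp ℝ 2 μ) μ := fun g =>
    (L1.integrable_coeFn (g : Lp ℝ 1 μ)).congr (hmem g).coeFn_toLp.symm
  have hTi : ∀ g : D, Integrable (T ((hmem g).toLp _)) μ := fun g => (hT _ (hint g)).1
  set φ : D →ₗ[ℝ] Lp ℝ 1 μ :=
    { toFun := fun g => (hTi g).toL1 _
      map_add' := fun a b => by
        rw [← Integrable.toL1_add]
        refine (Integrable.toL1_eq_toL1_iff _ _ _ _).2 ?_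
        have e : (hmem (a + b)).toLp _ = (hmem a).toLp _ + (hmem b).toLp _ := by
          rw [← MemLp.toLp_add]
          exact MemLp.toLp_congr _ _ (Lp.coeFn_add (a : Lp ℝ 1 μ) (b : Lp ℝ 1 μ))
        rw [e, map_add]
        exact Lp.coeFn_add _ _
      map_smul' := fun c a => by
        rw [RingHom.id_apply, ← Integrable.toL1_smul]
        refine (Integrable.toL1_eq_toL1_iff _ _ _ _).2 ?_
        have e : (hmem (c • a)).toLp _ = c • (hmem a).toLp _ := by
          rw [← MemLp.toLp_const_smul]
          exact MemLp.toLp_congr _ _ (Lp.coeFn_smul c (a : Lp ℝ 1 μ))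
        rw [e, map_smul]
        exact Lp.coeFn_smul _ _ } with hφ
  have hbound : ∀ g : D, ‖φ g‖ ≤ 1 * ‖g‖ := by
    intro g
    have h1 : ‖φ g‖ = ∫ x, ‖T ((hmem g).toLp _) x‖ ∂μ := by
      rw [L1.norm_eq_integral_norm]
      exact integral_congr_ae ((hTi g).coeFn_toL1.fun_comp norm)
    have h2 : ‖g‖ = ∫ x, ‖((hmem g).toLp _ : Lp ℝ 2 μ) x‖ ∂μ := by
      change ‖(g : Lp ℝ 1 μ)‖ = _
      rw [L1.norm_eq_integral_norm]
      exact integral_congr_ae ((hmem g).coeFn_toLp.symm.fun_comp norm)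
    rw [one_mul, h1, h2]
    exact (hT _ (hint g)).2
  have hdense : DenseRange (D.subtypeL : D → Lp ℝ 1 μ) := by
    intro g
    refine L1_induction (P := fun g => g ∈ closure (Set.range (D.subtypeL : D → Lp ℝ 1 μ)))
      isClosed_closure (fun g f hfg => subset_closure ?_) g
    exact ⟨⟨g, (Lp.memLp f).ae_eq hfg⟩, rfl⟩
  refine ⟨(φ.mkContinuous 1 hbound).extend D.subtypeL, ?_, ?_⟩
  · refine (ContinuousLinearMap.opNorm_extend_le (N := 1) _ hdense fun x => ?_).trans ?_
    · simp
    · simpa using φ.mkContinuous_norm_le zero_le_one hbound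
  · intro f g hfg
    have hg : MemLp g 2 μ := (Lp.memLp f).ae_eq hfg
    have h1 := ContinuousLinearMap.extend_eq (φ.mkContinuous 1 hbound) hdense
      isUniformEmbedding_subtype_val.isUniformInducing ⟨g, hg⟩
    have h2 : D.subtypeL ⟨g, hg⟩ = g := rfl
    rw [h2] at h1
    rw [h1]
    have h3 : hg.toLp _ = f := by
      rw [← Lp.toLp_coeFn f (Lp.memLp f)]
      exact MemLp.toLp_congr _ _ hfg.symm
    refine EventuallyEq.trans ?_ (hTi ⟨g, hg⟩).coeFn_toL1.symm
    change T f =ᵐ[μ] T (hg.toLp _)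
    rw [h3]

theorem AgreeOnL1L2.comp {T T' : Lp ℝ 2 μ →L[ℝ] Lp ℝ 2 μ}
    {S S' R : Lp ℝ 1 μ →L[ℝ] Lp ℝ 1 μ} (h : AgreeOnL1L2 T S) (h' : AgreeOnL1L2 T' S')
    (hR : AgreeOnL1L2 (T.comp T') R) : R = S.comp S' := by
  ext1 g
  refine L1_induction (P := fun g => R g = S.comp S' g)
    (isClosed_eq R.continuous (S.comp S').continuous) (fun g f hfg => ?_) g
  exact Lp.ext ((hR f g hfg).symm.trans (h _ _ (h' f g hfg)))

theorem AgreeOnL1L2.nonneg {T : Lp ℝ 2 μ →L[ℝ] Lp ℝ 2 μ} {S : Lp ℝ 1 μ →L[ℝ] Lp ℝ 1 μ}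
    (h : AgreeOnL1L2 T S)
    (hT : ∀ f : Lp ℝ 2 μ, (∀ᵐ x ∂μ, 0 ≤ f x) → ∀ᵐ x ∂μ, 0 ≤ T f x) {g : Lp ℝ 1 μ}
    (hg : 0 ≤ g) : 0 ≤ S g := by
  refine (Lp.simpleFunc.denseRange_coeSimpleFuncNonnegToLpNonneg 1 μ ℝ
    ENNReal.one_ne_top).induction_on (p := fun g : {g : Lp ℝ 1 μ // 0 ≤ g} => 0 ≤ S g)
    ⟨g, hg⟩ ?_ ?_
  · exact isClosed_le continuous_const (S.continuous.comp continuous_subtype_val)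
  · rintro ⟨k, hk⟩
    have hk0 : 0 ≤ (k : Lp ℝ 1 μ) := by exact_mod_cast hk
    change 0 ≤ S (k : Lp ℝ 1 μ)
    obtain ⟨f, hf, -⟩ := simpleFunc_exists_L2 k
    rw [← Lp.coeFn_nonneg]
    have h1 := hT f (by
      filter_upwards [hf, (Lp.coeFn_nonneg _).2 hk0] with x h1 h2
      rw [h1]; exact h2)
    filter_upwards [h1, h f _ hf] with x h2 h3
    rw [← h3]; exact h2

/-- For `f` vanishing outside of a set of finite measure, an `L¹`-contraction moves `f` in `L¹`
by at most twice what it moves it inside that set, which is controlled by the `L²`-norm. -/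
theorem integral_norm_sub_le {T : Lp ℝ 2 μ →L[ℝ] Lp ℝ 2 μ} {f : Lp ℝ 2 μ}
    (hf : Integrable f μ) (hT : Integrable (T f) μ) (hle : ∫ x, ‖T f x‖ ∂μ ≤ ∫ x, ‖f x‖ ∂μ)
    {s : Set E} (hs : MeasurableSet s) (hμs : μ s ≠ ⊤) (hfs : ∀ᵐ x ∂μ, x ∉ s → f x = 0) :
    ∫ x, ‖T f x - f x‖ ∂μ
      ≤ 2 * (‖T f - f‖ * ‖indicatorConstLp 2 hs hμs (1 : ℝ)‖) := by
  have h1 : ∫ x in s, ‖T f x - f x‖ ∂μ ≤ ‖T f - f‖ * ‖indicatorConstLp 2 hs hμs (1 : ℝ)‖ := by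
    have h2 := real_inner_le_norm |T f - f| (indicatorConstLp 2 hs hμs (1 : ℝ))
    rw [inner_indicator_eq, norm_abs_eq_norm] at h2
    refine le_trans (le_of_eq (integral_congr_ae (ae_restrict_of_ae ?_))) h2
    filter_upwards [Lp.coeFn_abs (T f - f), Lp.coeFn_sub (T f) f] with x h3 h4
    rw [h3, h4, Pi.sub_apply, Real.norm_eq_abs]
  have hi : Integrable (fun x => ‖T f x - f x‖) μ := (hT.sub hf).norm
  have h3 := integral_add_compl hs hi
  have h4 := integral_add_compl hs hT.norm
  have h5 := integral_add_compl hs hf.norm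
  have h6 : ∫ x in sᶜ, ‖f x‖ ∂μ = 0 := by
    rw [← integral_zero E ℝ (μ := μ.restrict sᶜ)]
    refine integral_congr_ae ((ae_restrict_iff' hs.compl).2 ?_)
    filter_upwards [hfs] with x hx hxs
    rw [hx hxs, norm_zero]
  have h7 : ∫ x in sᶜ, ‖T f x - f x‖ ∂μ = ∫ x in sᶜ, ‖T f x‖ ∂μ := by
    refine integral_congr_ae ((ae_restrict_iff' hs.compl).2 ?_)
    filter_upwards [hfs] with x hx hxs
    simp only [hx hxs, sub_zero]
  have h8 : ∫ x in s, ‖f x‖ ∂μ ≤ ∫ x in s, ‖T f x‖ ∂μ + ∫ x in s, ‖T f x - f x‖ ∂μ := by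
    rw [← integral_add hT.norm.integrableOn hi.integrableOn]
    refine integral_mono hf.norm.integrableOn (hT.norm.add hi).integrableOn fun x => ?_
    have := norm_sub_le (T f x) (T f x - f x)
    rwa [sub_sub_cancel] at this
  linarith

/-- A semigroup on `L²` whose adjoint is sub-Markovian extends to a `C₀`-semigroup of contractions
on `L¹`. -/
theorem exists_isL1Extension [SigmaFinite μ] {T : ℝ → Lp ℝ 2 μ →L[ℝ] Lp ℝ 2 μ}
    (hT : IsC0ContractionSemigroup T)
    (hadj : ∀ t : ℝ, 0 < t → IsSubMarkovian (ContinuousLinearMap.adjoint (T t))) :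
    ∃ S : ℝ → Lp ℝ 1 μ →L[ℝ] Lp ℝ 1 μ, IsL1Extension T S := by
  have hL1 : ∀ t : ℝ, 0 ≤ t → ∀ f : Lp ℝ 2 μ, Integrable f μ →
      Integrable (T t f) μ ∧ ∫ x, ‖T t f x‖ ∂μ ≤ ∫ x, ‖f x‖ ∂μ := by
    intro t ht f hf
    rcases ht.eq_or_lt with rfl | ht
    · rw [hT.zero]; exact ⟨hf, le_rfl⟩
    · exact integral_norm_le_of_adjoint_isSubMarkovian (hadj t ht) hf
  have hex : ∀ t : ℝ, ∃ S : Lp ℝ 1 μ →L[ℝ] Lp ℝ 1 μ, 0 ≤ t → ‖S‖ ≤ 1 ∧ AgreeOnL1L2 (T t) S := by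
    intro t
    by_cases ht : 0 ≤ t
    · obtain ⟨S, hS⟩ := exists_agreeOnL1L2 (hL1 t ht)
      exact ⟨S, fun _ => hS⟩
    · exact ⟨0, fun h => absurd h ht⟩
  choose S hS using hex
  refine ⟨S, ⟨?_, ?_, fun t ht => (hS t ht).1, ?_⟩, fun t ht => (hS t ht.le).2⟩
  · ext1 g
    refine L1_induction (P := fun g => S 0 g = ContinuousLinearMap.id ℝ _ g)
      (isClosed_eq (S 0).continuous continuous_id) (fun g f hfg => ?_) g
    have := (hS 0 le_rfl).2 f g hfg
    rw [hT.zero] at this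
    exact Lp.ext (this.symm.trans hfg)
  · intro s t hs ht
    refine AgreeOnL1L2.comp (hS s hs).2 (hS t ht).2 ?_
    rw [← hT.add s t hs ht]
    exact (hS (s + t) (add_nonneg hs ht)).2
  · have hsimple : ∀ k : Lp.simpleFunc ℝ 1 μ,
        Tendsto (fun t => S t (k : Lp ℝ 1 μ)) (𝓝[>] 0) (𝓝 (k : Lp ℝ 1 μ)) := by
      intro k
      obtain ⟨f, hfk, s, hs, hμs, hfs⟩ := simpleFunc_exists_L2 k
      have hf : Integrable f μ := (L1.integrable_coeFn (k : Lp ℝ 1 μ)).congr hfk.symm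
      have h1 := ((tendsto_iff_norm_sub_tendsto_zero.1 (hT.continuous f)).mul_const
        ‖indicatorConstLp 2 hs hμs (1 : ℝ)‖).const_mul 2
      rw [zero_mul, mul_zero] at h1
      refine tendsto_iff_norm_sub_tendsto_zero.2
        (squeeze_zero' (Eventually.of_forall fun _ => norm_nonneg _) ?_ h1)
      filter_upwards [self_mem_nhdsWithin] with t ht
      have ht : (0 : ℝ) < t := ht
      have h2 := hL1 t ht.le f hf
      refine le_trans (le_of_eq ?_) (integral_norm_sub_le hf h2.1 h2.2 hs hμs hfs)
      rw [L1.norm_eq_integral_norm]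
      refine integral_congr_ae ?_
      filter_upwards [Lp.coeFn_sub (S t (k : Lp ℝ 1 μ)) (k : Lp ℝ 1 μ),
        (hS t ht.le).2 f _ hfk, hfk] with x e1 e2 e3
      rw [e1, Pi.sub_apply, e2, e3]
    intro g
    rw [Metric.tendsto_nhds]
    intro ε hε
    obtain ⟨k, hk⟩ := (Lp.simpleFunc.denseRange (E := ℝ) (μ := μ) ENNReal.one_ne_top).exists_dist_lt
      g (by positivity : 0 < ε / 3)
    filter_upwards [self_mem_nhdsWithin, Metric.tendsto_nhds.1 (hsimple k) (ε / 3) (by positivity)]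
      with t ht hkt
    have h1 : dist (S t g) (S t (k : Lp ℝ 1 μ)) ≤ dist g (k : Lp ℝ 1 μ) := by
      rw [dist_eq_norm, dist_eq_norm, ← map_sub]
      simpa using (S t).le_of_opNorm_le (hS t (le_of_lt ht)).1 (g - (k : Lp ℝ 1 μ))
    have h2 := dist_triangle4 (S t g) (S t (k : Lp ℝ 1 μ)) (k : Lp ℝ 1 μ) g
    rw [dist_comm (k : Lp ℝ 1 μ) g] at h2
    linarith

end L1

/-! ### Potentials and resolvents -/

section Potential

variable {E : Type*} [MeasurableSpace E] {μ : Measure E}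

theorem IsL1Extension.agreeOnL1L2 {T : ℝ → Lp ℝ 2 μ →L[ℝ] Lp ℝ 2 μ}
    {S : ℝ → Lp ℝ 1 μ →L[ℝ] Lp ℝ 1 μ} (hS : IsL1Extension T S) (hT : IsC0ContractionSemigroup T)
    {t : ℝ} (ht : 0 ≤ t) : AgreeOnL1L2 (T t) (S t) := by
  rcases ht.eq_or_lt with rfl | ht
  · intro f g hfg
    rw [hT.zero, hS.1.zero]
    exact hfg
  · exact hS.2 t ht

theorem IsUnitValued.integrable_mul_L1 {f : Lp ℝ 2 μ} (hf : IsUnitValued f) (g : Lp ℝ 1 μ) :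
    Integrable (fun x => f x * g x) μ := by
  refine (L1.integrable_coeFn g).bdd_mul (c := 1) (Lp.aestronglyMeasurable f) ?_
  filter_upwards [hf] with x hx
  rw [Real.norm_eq_abs, abs_of_nonneg hx.1]
  exact hx.2

/-- Integration against a `[0, 1]`-valued function is a continuous functional on `L¹`. -/
theorem IsUnitValued.exists_pairing {f : Lp ℝ 2 μ} (hf : IsUnitValued f) :
    ∃ ψ : Lp ℝ 1 μ →L[ℝ] ℝ, ∀ g, ψ g = ∫ x, f x * g x ∂μ := by
  let φ : Lp ℝ 1 μ →ₗ[ℝ] ℝ :=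
    { toFun := fun g => ∫ x, f x * g x ∂μ
      map_add' := fun a b => by
        rw [← integral_add (hf.integrable_mul_L1 a) (hf.integrable_mul_L1 b)]
        refine integral_congr_ae ?_
        filter_upwards [Lp.coeFn_add a b] with x hx
        rw [hx, Pi.add_apply, mul_add]
      map_smul' := fun c a => by
        rw [RingHom.id_apply, smul_eq_mul, ← integral_const_mul]
        refine integral_congr_ae ?_
        filter_upwards [Lp.coeFn_smul c a] with x hx
        rw [hx, Pi.smul_apply, smul_eq_mul, mul_left_comm] }
  refine ⟨φ.mkContinuous 1 fun g => ?_, fun g => rfl⟩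
  rw [one_mul, L1.norm_eq_integral_norm]
  refine norm_integral_le_of_norm_le (L1.integrable_coeFn g).norm ?_
  filter_upwards [hf] with x hx
  rw [norm_mul, Real.norm_eq_abs, abs_of_nonneg hx.1]
  exact mul_le_of_le_one_left (norm_nonneg _) hx.2

theorem IsC0ContractionSemigroup.intervalIntegrable {X : Type*} [NormedAddCommGroup X]
    [NormedSpace ℝ X] {S : ℝ → X →L[ℝ] X}
    (hS : IsC0ContractionSemigroup S) (g : X) {a b : ℝ} (ha : 0 ≤ a) (hab : a ≤ b) :
    IntervalIntegrable (fun t => S t g) volume a b := by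
  refine ((hS.continuous_orbit g).intervalIntegrable a b).congr fun t ht => ?_
  rw [Set.uIoc_of_le hab] at ht
  simp only [max_eq_left (ha.trans ht.1.le)]

theorem integral_mul_integral_semigroup {S : ℝ → Lp ℝ 1 μ →L[ℝ] Lp ℝ 1 μ}
    (hS : IsC0ContractionSemigroup S) {f : Lp ℝ 2 μ} (hf : IsUnitValued f) (g : Lp ℝ 1 μ) {N : ℝ}
    (hN : 0 ≤ N) :
    ∫ x, f x * (∫ t in (0 : ℝ)..N, S t g : Lp ℝ 1 μ) x ∂μ
      = ∫ t in (0 : ℝ)..N, ∫ x, f x * S t g x ∂μ := by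
  obtain ⟨ψ, hψ⟩ := hf.exists_pairing
  simp only [← hψ]
  exact (ψ.intervalIntegral_comp_comm (hS.intervalIntegrable g le_rfl hN)).symm

theorem IsL1Extension.integral_mul_eq_inner {T : ℝ → Lp ℝ 2 μ →L[ℝ] Lp ℝ 2 μ}
    {S : ℝ → Lp ℝ 1 μ →L[ℝ] Lp ℝ 1 μ} (hS : IsL1Extension T S) (hT : IsC0ContractionSemigroup T)
    {f : Lp ℝ 2 μ} {g : Lp ℝ 1 μ} (hfg : f =ᵐ[μ] g) {t : ℝ} (ht : 0 ≤ t) :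
    ∫ x, f x * S t g x ∂μ = inner ℝ f (T t f) := by
  rw [inner_eq_integral_mul]
  refine integral_congr_ae ?_
  filter_upwards [hS.agreeOnL1L2 hT ht f g hfg] with x hx
  rw [hx]

/-- This instance is what the positivity of Bochner integrals with values in `L¹` relies on. -/
instance isOrderedModule_L1 : IsOrderedModule ℝ (Lp ℝ 1 μ) where
  smul_le_smul_of_nonneg_left c hc f g hfg := by
    rw [← Lp.coeFn_le] at hfg ⊢
    filter_upwards [hfg, Lp.coeFn_smul c f, Lp.coeFn_smul c g] with x h1 h2 h3
    rw [h2, h3]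
    exact mul_le_mul_of_nonneg_left h1 hc
  smul_le_smul_of_nonneg_right f hf a b hab := by
    rw [← Lp.coeFn_nonneg] at hf
    rw [← Lp.coeFn_le]
    filter_upwards [hf, Lp.coeFn_smul a f, Lp.coeFn_smul b f] with x h1 h2 h3
    rw [h2, h3]
    exact mul_le_mul_of_nonneg_right hab h1

/-- The Laplace transform of `t ↦ (f, T_t f)`, truncated at `N`. -/
theorem integral_exp_inner_semigroup {T G : ℝ → Lp ℝ 2 μ →L[ℝ] Lp ℝ 2 μ}
    {L : Lp ℝ 2 μ →ₗ.[ℝ] Lp ℝ 2 μ} (hT : IsC0ContractionSemigroup T)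
    (hL : IsSemigroupGenerator L T) (hG : IsResolventGenerator L G) {α N : ℝ} (hα : 0 < α)
    (hN : 0 ≤ N) (f : Lp ℝ 2 μ) :
    ∫ t in (0 : ℝ)..N, Real.exp (-α * t) * inner ℝ f (T (max t 0) f)
      = inner ℝ f (G α f) - Real.exp (-α * N) * inner ℝ f (G α (T N f)) := by
  have hc : Continuous fun t : ℝ => Real.exp (-α * t) • T (max t 0) f := by
    have h0 : Continuous fun t : ℝ => Real.exp (-α * t) := by fun_prop
    exact h0.smul (hT.continuous_orbit f)
  have h1 := (innerSL ℝ f).intervalIntegral_comp_comm (hc.intervalIntegrable (μ := volume) 0 N)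
  rw [integral_exp_semigroup_eq hT hL hG hα hN f] at h1
  simpa [map_sub, map_smul, inner_sub_right, inner_smul_right] using h1

theorem continuous_inner_orbit {T : ℝ → Lp ℝ 2 μ →L[ℝ] Lp ℝ 2 μ}
    (hT : IsC0ContractionSemigroup T) (f : Lp ℝ 2 μ) :
    Continuous fun t : ℝ => (inner ℝ f (T (max t 0) f) : ℝ) :=
  continuous_const.inner (hT.continuous_orbit f)

theorem inner_resolvent_le {T G : ℝ → Lp ℝ 2 μ →L[ℝ] Lp ℝ 2 μ}
    {L : Lp ℝ 2 μ →ₗ.[ℝ] Lp ℝ 2 μ} (hT : IsC0ContractionSemigroup T)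
    (hL : IsSemigroupGenerator L T) (hG : IsResolventGenerator L G)
    {f : Lp ℝ 2 μ} (hpos : ∀ t : ℝ, 0 ≤ t → 0 ≤ (inner ℝ f (T t f) : ℝ)) {M : ℝ}
    (hM : ∀ N : ℕ, ∫ t in (0 : ℝ)..N, inner ℝ f (T (max t 0) f) ≤ M) {α : ℝ} (hα : 0 < α) :
    inner ℝ f (G α f) ≤ M := by
  have hcont := continuous_inner_orbit hT f
  have key : ∀ N : ℕ, inner ℝ f (G α f)
      ≤ M + Real.exp (-α * N) * (‖f‖ * (‖G α‖ * ‖f‖)) := by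
    intro N
    have hN : (0 : ℝ) ≤ N := N.cast_nonneg
    have h1 := integral_exp_inner_semigroup hT hL hG hα hN f
    have h2 : ∫ t in (0 : ℝ)..N, Real.exp (-α * t) * inner ℝ f (T (max t 0) f)
        ≤ ∫ t in (0 : ℝ)..N, inner ℝ f (T (max t 0) f) := by
      refine intervalIntegral.integral_mono_on hN
        (Continuous.intervalIntegrable (by fun_prop) _ _) (hcont.intervalIntegrable _ _) ?_
      intro t ht
      refine mul_le_of_le_one_left (hpos _ (le_max_right _ _)) (Real.exp_le_one_iff.2 ?_)
      nlinarith [ht.1]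
    have h3 : inner ℝ f (G α (T N f)) ≤ ‖f‖ * (‖G α‖ * ‖f‖) := by
      refine (real_inner_le_norm _ _).trans (mul_le_mul_of_nonneg_left ?_ (norm_nonneg _))
      exact ((G α).le_opNorm _).trans
        (mul_le_mul_of_nonneg_left (hT.norm_apply_le hN f) (norm_nonneg _))
    have h4 := mul_le_mul_of_nonneg_left h3 (Real.exp_pos (-α * N)).le
    linarith [hM N]
  have hlim : Tendsto (fun N : ℕ => M + Real.exp (-α * N) * (‖f‖ * (‖G α‖ * ‖f‖))) atTop
      (𝓝 (M + 0 * (‖f‖ * (‖G α‖ * ‖f‖)))) := by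
    refine Tendsto.const_add _ (Tendsto.mul_const _ ?_)
    refine Real.tendsto_exp_atBot.comp ?_
    exact Tendsto.const_mul_atTop_of_neg (neg_lt_zero.2 hα) tendsto_natCast_atTop_atTop
  rw [zero_mul, add_zero] at hlim
  exact ge_of_tendsto' hlim key

theorem integral_inner_semigroup_le {T G : ℝ → Lp ℝ 2 μ →L[ℝ] Lp ℝ 2 μ}
    {L : Lp ℝ 2 μ →ₗ.[ℝ] Lp ℝ 2 μ} (hT : IsC0ContractionSemigroup T)
    (hL : IsSemigroupGenerator L T) (hG : IsResolventGenerator L G)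
    {f : Lp ℝ 2 μ} (hpos : ∀ t : ℝ, 0 ≤ t → 0 ≤ (inner ℝ f (T t f) : ℝ))
    (hGpos : ∀ α t : ℝ, 0 < α → 0 ≤ t → 0 ≤ (inner ℝ f (G α (T t f)) : ℝ)) {C : ℝ}
    (hC : ∀ α : ℝ, 0 < α → inner ℝ f (G α f) ≤ C) {N : ℝ} (hN : 0 ≤ N) :
    ∫ t in (0 : ℝ)..N, inner ℝ f (T (max t 0) f) ≤ C := by
  have hcont := continuous_inner_orbit hT f
  have key : ∀ α : ℝ, 0 < α →
      ∫ t in (0 : ℝ)..N, inner ℝ f (T (max t 0) f) ≤ Real.exp (α * N) * C := by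
    intro α hα
    have h1 := integral_exp_inner_semigroup hT hL hG hα hN f
    have h2 : ∫ t in (0 : ℝ)..N, inner ℝ f (T (max t 0) f)
        ≤ ∫ t in (0 : ℝ)..N,
          Real.exp (α * N) * (Real.exp (-α * t) * inner ℝ f (T (max t 0) f)) := by
      refine intervalIntegral.integral_mono_on hN (hcont.intervalIntegrable _ _)
        (Continuous.intervalIntegrable (by fun_prop) _ _) ?_
      intro t ht
      rw [← mul_assoc, ← Real.exp_add]
      refine le_mul_of_one_le_left (hpos _ (le_max_right _ _)) (Real.one_le_exp ?_)
      nlinarith [ht.2]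
    rw [intervalIntegral.integral_const_mul, h1] at h2
    refine h2.trans (mul_le_mul_of_nonneg_left ?_ (Real.exp_pos _).le)
    have h3 := mul_nonneg (Real.exp_pos (-α * N)).le (hGpos α N hα hN)
    linarith [hC α hα]
  have hlim : Tendsto (fun α : ℝ => Real.exp (α * N) * C) (𝓝[>] 0)
      (𝓝 (Real.exp (0 * N) * C)) :=
    (Continuous.tendsto (by fun_prop) 0).mono_left nhdsWithin_le_nhds
  rw [zero_mul, Real.exp_zero, one_mul] at hlim
  exact ge_of_tendsto hlim (by filter_upwards [self_mem_nhdsWithin] with α hα using key α hα)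

/-- For a transient positive semigroup there is a strictly positive `f` of finite energy, i.e. with
`∫₀^∞ (f, T_t f) dt < ∞`. -/
theorem IsTransient.exists_finite_energy {T : ℝ → Lp ℝ 2 μ →L[ℝ] Lp ℝ 2 μ}
    (htr : IsTransient T) (hT : IsC0ContractionSemigroup T)
    (hpos : ∀ t : ℝ, 0 ≤ t → ∀ f : Lp ℝ 2 μ, (∀ᵐ x ∂μ, 0 ≤ f x) → ∀ᵐ x ∂μ, 0 ≤ T t f x) :
    ∃ (f : Lp ℝ 2 μ) (M : ℝ), IsUnitValued f ∧ (∀ᵐ x ∂μ, 0 < f x) ∧ Integrable f μ ∧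
      ∀ N : ℕ, ∫ t in (0 : ℝ)..N, inner ℝ f (T (max t 0) f) ≤ M := by
  obtain ⟨S, hS, g, hg, hfin⟩ := htr
  have hgm : Measurable g := (Lp.stronglyMeasurable g).measurable
  have hpm : Measurable (potential S g) :=
    Measurable.iSup fun N => (Lp.stronglyMeasurable _).measurable.ennreal_ofReal
  -- Dividing by `1 + G g` gives `f (G f) ≤ f (G g) ≤ g`, which is integrable.
  set F : E → ℝ := fun x => min (max (g x) 0) 1 / (1 + (potential S g x).toReal) with hF
  have hFm : Measurable F :=
    ((hgm.max measurable_const).min measurable_const).div (hpm.ennreal_toReal.const_add 1)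
  have hden : ∀ x, 1 ≤ 1 + (potential S g x).toReal := fun x =>
    le_add_of_nonneg_right ENNReal.toReal_nonneg
  have hF0 : ∀ x, 0 ≤ F x := fun x =>
    div_nonneg (le_min (le_max_right _ _) zero_le_one) (zero_le_one.trans (hden x))
  have hFle : ∀ x, F x ≤ min (max (g x) 0) 1 := fun x =>
    div_le_self (le_min (le_max_right _ _) zero_le_one) (hden x)
  have hF1 : ∀ x, F x ≤ 1 := fun x => (hFle x).trans (min_le_right _ _)
  have hFg : ∀ᵐ x ∂μ, F x ≤ g x := by
    filter_upwards [hg] with x hx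
    refine (hFle x).trans ((min_le_left _ _).trans ?_)
    rw [max_eq_left hx.le]
  have hFi : Integrable F μ := by
    refine (L1.integrable_coeFn g).mono hFm.aestronglyMeasurable ?_
    filter_upwards [hFg] with x hx
    rw [Real.norm_eq_abs, Real.norm_eq_abs, abs_of_nonneg (hF0 x)]
    exact hx.trans (le_abs_self _)
  have hF2 : MemLp F 2 μ := by
    rw [memLp_two_iff_integrable_sq hFm.aestronglyMeasurable]
    refine hFi.mono (hFm.pow_const 2).aestronglyMeasurable (Eventually.of_forall fun x => ?_)
    rw [Real.norm_eq_abs, Real.norm_eq_abs, abs_of_nonneg (hF0 x), abs_of_nonneg (sq_nonneg _)]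
    nlinarith [hF0 x, hF1 x]
  set f : Lp ℝ 2 μ := hF2.toLp F with hf
  set f₁ : Lp ℝ 1 μ := hFi.toL1 F with hf₁
  have hfF : f =ᵐ[μ] F := hF2.coeFn_toLp
  have hf₁F : f₁ =ᵐ[μ] F := hFi.coeFn_toL1
  have hff₁ : f =ᵐ[μ] f₁ := hfF.trans hf₁F.symm
  have hfu : IsUnitValued f := by
    filter_upwards [hfF] with x hx
    rw [hx]; exact ⟨hF0 x, hF1 x⟩
  refine ⟨f, ∫ x, g x ∂μ, hfu, ?_, hFi.congr hfF.symm, fun N => ?_⟩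
  · filter_upwards [hfF, hg] with x h1 h2
    rw [h1]
    exact div_pos (lt_min (lt_max_of_lt_left h2) one_pos) (one_pos.trans_le (hden x))
  have hN : (0 : ℝ) ≤ N := N.cast_nonneg
  have hle : f₁ ≤ g := by
    rw [← Lp.coeFn_le]
    filter_upwards [hf₁F, hFg] with x h1 h2
    rw [h1]; exact h2
  have h1 : ∀ t : ℝ, 0 ≤ t → inner ℝ f (T t f) ≤ ∫ x, f x * S t g x ∂μ := by
    intro t ht
    rw [← hS.integral_mul_eq_inner hT hff₁ ht]
    refine integral_mono_ae (hfu.integrable_mul_L1 _) (hfu.integrable_mul_L1 _) ?_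
    have h2 := (hS.agreeOnL1L2 hT ht).nonneg (hpos t ht) (sub_nonneg.2 hle)
    rw [map_sub, sub_nonneg, ← Lp.coeFn_le] at h2
    filter_upwards [h2, hfu] with x h3 h4
    exact mul_le_mul_of_nonneg_left h3 h4.1
  obtain ⟨ψ, hψ⟩ := hfu.exists_pairing
  have h2 : ∫ t in (0 : ℝ)..N, inner ℝ f (T (max t 0) f)
      ≤ ∫ t in (0 : ℝ)..N, ∫ x, f x * S t g x ∂μ := by
    refine intervalIntegral.integral_mono_on hN
      ((continuous_inner_orbit hT f).intervalIntegrable _ _) ?_ ?_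
    · simp only [← hψ]
      refine ((ψ.continuous.comp (hS.1.continuous_orbit g)).intervalIntegrable 0 (N : ℝ)).congr
        fun t ht => ?_
      rw [Set.uIoc_of_le hN] at ht
      simp only [Function.comp_apply, max_eq_left ht.1.le]
    · intro t ht
      rw [max_eq_left ht.1]
      exact h1 t ht.1
  refine h2.trans ?_
  rw [← integral_mul_integral_semigroup hS.1 hfu g hN]
  refine integral_mono_ae (hfu.integrable_mul_L1 _) (L1.integrable_coeFn g) ?_
  filter_upwards [hfF, hfin, hg] with x e1 e2 e3
  have h3 : (∫ t in (0 : ℝ)..N, S t g : Lp ℝ 1 μ) x ≤ (potential S g x).toReal :=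
    (ENNReal.ofReal_le_iff_le_toReal e2.ne).1
      (le_iSup (fun N : ℕ => ENNReal.ofReal ((∫ t in (0 : ℝ)..N, S t g : Lp ℝ 1 μ) x)) N)
  rw [e1]
  refine (mul_le_mul_of_nonneg_left h3 (hF0 x)).trans ?_
  have h4 : F x * (potential S g x).toReal ≤ F x * (1 + (potential S g x).toReal) :=
    mul_le_mul_of_nonneg_left (by linarith) (hF0 x)
  refine h4.trans ?_
  rw [hF]
  simp only
  rw [div_mul_cancel₀ _ (zero_lt_one.trans_le (hden x)).ne']
  exact (min_le_left _ _).trans (max_eq_left e3.le).le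

/-- Conversely, finite energy of a strictly positive integrable function makes its potential
finite almost everywhere, by monotone convergence. -/
theorem isTransient_of_finite_energy [SigmaFinite μ] {T : ℝ → Lp ℝ 2 μ →L[ℝ] Lp ℝ 2 μ}
    (hT : IsC0ContractionSemigroup T)
    (hadj : ∀ t : ℝ, 0 < t → IsSubMarkovian (ContinuousLinearMap.adjoint (T t)))
    (hpos : ∀ t : ℝ, 0 ≤ t → ∀ f : Lp ℝ 2 μ, (∀ᵐ x ∂μ, 0 ≤ f x) → ∀ᵐ x ∂μ, 0 ≤ T t f x)
    {f : Lp ℝ 2 μ} (hfu : IsUnitValued f) (hf0 : ∀ᵐ x ∂μ, 0 < f x) (hfi : Integrable f μ) {C : ℝ}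
    (hC : ∀ N : ℕ, ∫ t in (0 : ℝ)..N, inner ℝ f (T (max t 0) f) ≤ C) : IsTransient T := by
  obtain ⟨S, hS⟩ := exists_isL1Extension hT hadj
  set g : Lp ℝ 1 μ := hfi.toL1 f with hg
  have hfg : f =ᵐ[μ] g := hfi.coeFn_toL1.symm
  refine ⟨S, hS, g, ?_, ?_⟩
  · filter_upwards [hf0, hfg] with x h1 h2
    rw [← h2]; exact h1
  set I : ℕ → Lp ℝ 1 μ := fun N => ∫ t in (0 : ℝ)..N, S t g with hI
  have hg0 : 0 ≤ g := by
    rw [← Lp.coeFn_nonneg]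
    filter_upwards [hf0, hfg] with x h1 h2
    rw [← h2]; exact h1.le
  have hSg : ∀ t : ℝ, 0 ≤ t → 0 ≤ S t g := fun t ht =>
    (hS.agreeOnL1L2 hT ht).nonneg (hpos t ht) hg0
  have hnonneg : ∀ a b : ℝ, 0 ≤ a → a ≤ b → 0 ≤ ∫ t in a..b, S t g := by
    intro a b ha hab
    rw [intervalIntegral.integral_of_le hab]
    refine integral_nonneg_of_ae ((ae_restrict_iff' measurableSet_Ioc).2
      (Eventually.of_forall fun t ht => ?_))
    exact hSg t (ha.trans ht.1.le)
  have hI0 : ∀ N, 0 ≤ I N := fun N => hnonneg _ _ le_rfl N.cast_nonneg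
  have hmono : ∀ N, I N ≤ I (N + 1) := by
    intro N
    have hN : (0 : ℝ) ≤ N := N.cast_nonneg
    have hN1 : (N : ℝ) ≤ (N + 1 : ℕ) := by push_cast; linarith
    change _ ≤ ∫ t in (0 : ℝ)..(N + 1 : ℕ), S t g
    rw [← intervalIntegral.integral_add_adjacent_intervals
      (hS.1.intervalIntegrable g le_rfl hN) (hS.1.intervalIntegrable g hN hN1)]
    exact le_add_of_nonneg_right (hnonneg _ _ hN hN1)
  have hmono' : ∀ᵐ x ∂μ, Monotone fun N => I N x := by
    have h1 : ∀ᵐ x ∂μ, ∀ N, I N x ≤ I (N + 1) x :=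
      ae_all_iff.2 fun N => (Lp.coeFn_le _ _).2 (hmono N)
    filter_upwards [h1] with x hx using monotone_nat_of_le_succ hx
  have hbound : ∀ N, ∫⁻ x, ENNReal.ofReal (f x) * ENNReal.ofReal (I N x) ∂μ
      ≤ ENNReal.ofReal C := by
    intro N
    have hN : (0 : ℝ) ≤ N := N.cast_nonneg
    have h1 : ∫ x, f x * I N x ∂μ ≤ C := by
      rw [integral_mul_integral_semigroup hS.1 hfu g hN]
      refine le_trans (le_of_eq (intervalIntegral.integral_congr fun t ht => ?_)) (hC N)
      rw [Set.uIcc_of_le hN] at ht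
      rw [max_eq_left ht.1]
      exact hS.integral_mul_eq_inner hT hfg ht.1
    have h2 : 0 ≤ᵐ[μ] fun x => f x * I N x := by
      filter_upwards [hfu, (Lp.coeFn_nonneg _).2 (hI0 N)] with x h3 h4
      exact mul_nonneg h3.1 h4
    have h3 := ofReal_integral_eq_lintegral_ofReal (hfu.integrable_mul_L1 (I N)) h2
    refine le_trans (le_of_eq ?_) (ENNReal.ofReal_le_ofReal h1)
    rw [h3]
    refine lintegral_congr_ae ?_
    filter_upwards [hfu] with x hx
    rw [ENNReal.ofReal_mul hx.1]
  have hfm : Measurable fun x => ENNReal.ofReal (f x) :=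
    (Lp.stronglyMeasurable f).measurable.ennreal_ofReal
  have hIm : ∀ N, Measurable fun x => ENNReal.ofReal (I N x) := fun N =>
    (Lp.stronglyMeasurable (I N)).measurable.ennreal_ofReal
  have hsup : ∫⁻ x, ENNReal.ofReal (f x) * potential S g x ∂μ ≤ ENNReal.ofReal C := by
    have h1 : ∀ x, ENNReal.ofReal (f x) * potential S g x
        = ⨆ N, ENNReal.ofReal (f x) * ENNReal.ofReal (I N x) := fun x => by
      rw [potential, ENNReal.mul_iSup]
    simp only [h1]
    rw [lintegral_iSup' (f := fun N x => ENNReal.ofReal (f x) * ENNReal.ofReal (I N x))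
      (fun N => (hfm.mul (hIm N)).aemeasurable)]
    · exact iSup_le hbound
    · filter_upwards [hmono'] with x hx
      intro m n hmn
      exact mul_le_mul_right (ENNReal.ofReal_le_ofReal (hx hmn)) _
  have hpm : Measurable (potential S g) := Measurable.iSup hIm
  have hfin := ae_lt_top (hfm.mul hpm) (hsup.trans_lt ENNReal.ofReal_lt_top).ne
  filter_upwards [hfin, hf0] with x h1 h2
  by_contra h3
  rw [not_lt, top_le_iff] at h3
  rw [Pi.mul_apply, h3, ENNReal.mul_top (ENNReal.ofReal_pos.2 h2).ne'] at h1
  exact lt_irrefl _ h1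

end Potential

/-! ### Domination of forms and transience -/

section Domination

variable {E : Type*} [MeasurableSpace E] {μ : Measure E}

/-- By the sector condition, a bound on `(f, G_α f)` that is uniform in `α` turns `v ↦ (f, v)` into
a functional that is bounded by the energy alone. -/
theorem inner_le_of_isSectorial {H : Type*} [NormedAddCommGroup H] [InnerProductSpace ℝ H]
    {B : PartialForm H} (hB : ∀ u : B.dom, 0 ≤ B.form u u) {K : ℝ} (hK : 0 < K)
    (hsec : ∀ u v : B.dom,
      |B.form u v| ≤ K * Real.sqrt (B.form u u) * Real.sqrt (B.form v v))
    {G : ℝ → H →L[ℝ] H} (hG : IsFormResolvent B G) {f : H} {M : ℝ}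
    (hM : ∀ α : ℝ, 0 < α → inner ℝ f (G α f) ≤ M) (v : B.dom) :
    inner ℝ f (v : H) ≤ K * Real.sqrt M * Real.sqrt (B.form v v) := by
  have key : ∀ α : ℝ, 0 < α → inner ℝ f (v : H)
      ≤ K * Real.sqrt M * Real.sqrt (B.form v v) + Real.sqrt α * (Real.sqrt M * ‖(v : H)‖) := by
    intro α hα
    obtain ⟨u, hu, hform⟩ := hG.2 α hα f
    have h1 := hform u
    have h2 := hM α hα
    rw [← hu] at h2
    rw [real_inner_self_eq_norm_sq] at h1
    have h3 : 0 ≤ α * ‖(u : H)‖ ^ 2 := by positivity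
    have h4 := hB u
    have h5 : Real.sqrt (B.form u u) ≤ Real.sqrt M := Real.sqrt_le_sqrt (by linarith)
    have h6 : α * ‖(u : H)‖ ≤ Real.sqrt α * Real.sqrt M := by
      have e : α * ‖(u : H)‖ = Real.sqrt α * Real.sqrt (α * ‖(u : H)‖ ^ 2) := by
        rw [Real.sqrt_mul hα.le, Real.sqrt_sq (norm_nonneg _), ← mul_assoc,
          Real.mul_self_sqrt hα.le]
      rw [e]
      exact mul_le_mul_of_nonneg_left (Real.sqrt_le_sqrt (by linarith)) (Real.sqrt_nonneg _)
    have h7 := (le_abs_self _).trans (hsec u v)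
    have h8 : K * Real.sqrt (B.form u u) * Real.sqrt (B.form v v)
        ≤ K * Real.sqrt M * Real.sqrt (B.form v v) := by gcongr
    have h9 : α * inner ℝ (u : H) (v : H) ≤ Real.sqrt α * Real.sqrt M * ‖(v : H)‖ := by
      calc α * inner ℝ (u : H) (v : H) ≤ α * (‖(u : H)‖ * ‖(v : H)‖) :=
            mul_le_mul_of_nonneg_left (real_inner_le_norm _ _) hα.le
        _ = α * ‖(u : H)‖ * ‖(v : H)‖ := by ring
        _ ≤ _ := mul_le_mul_of_nonneg_right h6 (norm_nonneg _)
    linarith [hform v]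
  have hlim : Tendsto (fun α : ℝ => K * Real.sqrt M * Real.sqrt (B.form v v)
      + Real.sqrt α * (Real.sqrt M * ‖(v : H)‖)) (𝓝[>] 0)
      (𝓝 (K * Real.sqrt M * Real.sqrt (B.form v v)
        + Real.sqrt 0 * (Real.sqrt M * ‖(v : H)‖))) :=
    (Continuous.tendsto (by fun_prop) 0).mono_left nhdsWithin_le_nhds
  rw [Real.sqrt_zero, zero_mul, add_zero] at hlim
  exact ge_of_tendsto hlim (by filter_upwards [self_mem_nhdsWithin] with α hα using key α hα)

theorem le_sq_of_le_mul_sqrt {x c : ℝ} (hx : 0 ≤ x) (hc : 0 ≤ c) (h : x ≤ c * Real.sqrt x) :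
    x ≤ c ^ 2 := by
  have h1 := Real.sq_sqrt hx
  have h2 := Real.sqrt_nonneg x
  have h3 : Real.sqrt x ≤ c := by
    by_contra! h3
    nlinarith
  nlinarith

/-- Transience passes from the semigroup of a sectorial Dirichlet form `B` to any semigroup with
sub-Markovian adjoint and sub-Markovian resolvent `(G_α)` whose energy `(f, G_α f)` dominates
`B (G_α f, G_α f)`. -/
theorem isTransient_of_domination [SigmaFinite μ] {B : PartialForm (Lp ℝ 2 μ)}
    (hB : IsDirichletForm B) (hsec : IsSectorial B) {T₀ : ℝ → Lp ℝ 2 μ →L[ℝ] Lp ℝ 2 μ}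
    (hT₀ : IsFormSemigroup B T₀) {T G : ℝ → Lp ℝ 2 μ →L[ℝ] Lp ℝ 2 μ}
    {L : Lp ℝ 2 μ →ₗ.[ℝ] Lp ℝ 2 μ} (hT : IsC0ContractionSemigroup T)
    (hL : IsSemigroupGenerator L T) (hG : IsResolventGenerator L G)
    (hadj : ∀ t : ℝ, 0 < t → IsSubMarkovian (ContinuousLinearMap.adjoint (T t)))
    (hGsub : ∀ α : ℝ, 0 < α → IsSubMarkovian (α • G α))
    (hdom : ∀ α : ℝ, 0 < α → ∀ f : Lp ℝ 2 μ, IsEssBounded (G α f) →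
      ∃ v : B.dom, (v : Lp ℝ 2 μ) = G α f ∧ B.form v v ≤ inner ℝ f (G α f))
    (htr : IsTransient T₀) : IsTransient T := by
  have hpos_of_adj : ∀ {R : ℝ → Lp ℝ 2 μ →L[ℝ] Lp ℝ 2 μ}, IsC0ContractionSemigroup R →
      (∀ t : ℝ, 0 < t → IsSubMarkovian (ContinuousLinearMap.adjoint (R t))) →
      ∀ t : ℝ, 0 ≤ t → ∀ f : Lp ℝ 2 μ, (∀ᵐ x ∂μ, 0 ≤ f x) → ∀ᵐ x ∂μ, 0 ≤ R t f x := by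
    intro R hR hRadj t ht f hf
    rcases ht.eq_or_lt with rfl | ht
    · rw [hR.zero]; exact hf
    · exact nonneg_of_adjoint_isSubMarkovian (hRadj t ht) hf
  have hTpos := hpos_of_adj hT hadj
  have hT₀pos := hpos_of_adj hT₀.1 fun t ht => hT₀.adjoint_isSubMarkovian hB ht
  obtain ⟨f, M, hfu, hf0, hfi, hM⟩ := htr.exists_finite_energy hT₀.1 hT₀pos
  have hf0' : ∀ᵐ x ∂μ, 0 ≤ f x := hfu.mono fun x h => h.1
  obtain ⟨hT₀', G₀, L₀, hG₀, hLG₀, hLT₀⟩ := hT₀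
  have hM' : ∀ α : ℝ, 0 < α → inner ℝ f (G₀ α f) ≤ M := fun α hα =>
    inner_resolvent_le hT₀' hLT₀ hLG₀
      (fun t ht => inner_nonneg_of_ae hf0' (hT₀pos t ht f hf0')) hM hα
  have hGpos : ∀ α : ℝ, 0 < α → ∀ h : Lp ℝ 2 μ, (∀ᵐ x ∂μ, 0 ≤ h x) → 0 ≤ inner ℝ f (G α h) := by
    intro α hα h hh
    have h1 := inner_nonneg_of_ae hf0' ((hGsub α hα).nonneg hh)
    have h2 : (α • G α) h = α • G α h := rfl
    rw [h2, inner_smul_right] at h1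
    exact nonneg_of_mul_nonneg_right h1 hα
  obtain ⟨K, hK, hsec⟩ := hsec
  have hC : ∀ α : ℝ, 0 < α → inner ℝ f (G α f) ≤ (K * Real.sqrt M) ^ 2 := by
    intro α hα
    have hbdd : IsEssBounded (G α f) := by
      refine ⟨α⁻¹, ?_⟩
      filter_upwards [hGsub α hα f hfu, Lp.coeFn_smul α (G α f)] with x h1 h2
      have h3 : ((α • G α) f) x = α * G α f x := h2
      rw [h3] at h1
      rw [abs_of_nonneg (nonneg_of_mul_nonneg_right h1.1 hα), ← mul_one α⁻¹, ← div_eq_inv_mul,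
        le_div_iff₀' hα]
      exact h1.2
    obtain ⟨v, hv, hvle⟩ := hdom α hα f hbdd
    have h1 := inner_le_of_isSectorial hB.nonneg hK hsec hG₀ hM' v
    rw [hv] at h1
    refine le_sq_of_le_mul_sqrt (hGpos α hα f hf0') (by positivity) (h1.trans ?_)
    exact mul_le_mul_of_nonneg_left (Real.sqrt_le_sqrt hvle) (by positivity)
  refine isTransient_of_finite_energy hT hadj hTpos hfu hf0 hfi fun N =>
    integral_inner_semigroup_le hT hL hG
      (fun t ht => inner_nonneg_of_ae hf0' (hTpos t ht f hf0'))
      (fun α t hα ht => hGpos α hα _ (hTpos t ht f hf0')) hC N.cast_nonneg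

/-! ### The symmetric part -/

theorem symPart_form_apply {H : Type*} [NormedAddCommGroup H] [InnerProductSpace ℝ H]
    (B : PartialForm H) (u v : B.dom) :
    B.symPart.form u v = (B.form u v + B.form v u) / 2 := by
  change (1 / 2 : ℝ) * (B.form u v + B.form v u) = _
  ring

theorem symPart_form_self {H : Type*} [NormedAddCommGroup H] [InnerProductSpace ℝ H]
    (B : PartialForm H) (u : B.dom) : B.symPart.form u u = B.form u u := by
  rw [symPart_form_apply]; ring

theorem symPart_norm1 {H : Type*} [NormedAddCommGroup H] [InnerProductSpace ℝ H]
    (B : PartialForm H) (u : B.dom) : B.symPart.norm1 u = B.norm1 u := by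
  change Real.sqrt (B.symPart.form u u + ‖(u : H)‖ ^ 2) = _
  rw [symPart_form_self]; rfl

theorem abs_symPart_form_le {H : Type*} [NormedAddCommGroup H] [InnerProductSpace ℝ H]
    {B : PartialForm H} {N : B.dom → ℝ} {b : B.dom → B.dom → ℝ} {K : ℝ}
    (h : ∀ u v : B.dom, |B.form u v + b u v| ≤ K * N u * N v) (hb : ∀ u v, b u v = b v u)
    (u v : B.dom) : |B.symPart.form u v + b u v| ≤ K * N u * N v := by
  have h1 := abs_le.1 (h u v)
  have h2 := abs_le.1 (h v u)
  have h3 : K * N v * N u = K * N u * N v := by ring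
  rw [hb v u, h3] at h2
  rw [symPart_form_apply, abs_le]
  constructor <;> linarith [h1.1, h1.2, h2.1, h2.2]

theorem IsSectorial.symPart {H : Type*} [NormedAddCommGroup H] [InnerProductSpace ℝ H]
    {B : PartialForm H} (h : IsSectorial B) : IsSectorial B.symPart := by
  obtain ⟨K, hK, hsec⟩ := h
  refine ⟨K, hK, fun (u v : B.dom) => ?_⟩
  rw [symPart_form_self, symPart_form_self]
  simpa using abs_symPart_form_le (N := fun u => Real.sqrt (B.form u u)) (b := fun _ _ => 0)
    (by simpa using hsec) (fun _ _ => rfl) u v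

theorem IsDirichletForm.symPart {B : PartialForm (Lp ℝ 2 μ)} (hB : IsDirichletForm B) :
    IsDirichletForm B.symPart where
  dense := hB.dense
  nonneg := fun (u : B.dom) => (hB.nonneg u).trans_eq (symPart_form_self B u).symm
  complete := fun (w : ℕ → B.dom) hw => by
    have h : B.symPart.norm1 = B.norm1 := funext (symPart_norm1 B)
    rw [h] at hw ⊢
    exact hB.complete w hw
  weakSector := by
    obtain ⟨K, hK, h⟩ := hB.weakSector
    refine ⟨K, hK, fun (u v : B.dom) => ?_⟩
    rw [symPart_norm1, symPart_norm1]
    exact abs_symPart_form_le h (fun u v => real_inner_comm _ _) u v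
  unitContraction := fun (u : B.dom) => by
    obtain ⟨w, hw, h1, h2⟩ := hB.unitContraction u
    refine ⟨w, hw, ?_, ?_⟩
    · refine le_of_le_of_eq ?_ (symPart_form_apply B (u + w) (u - w)).symm
      linarith
    · refine le_of_le_of_eq ?_ (symPart_form_apply B (u - w) (u + w)).symm
      linarith

/-- Transience passes from a sectorial Dirichlet form to any Dirichlet form that has the same
quadratic form on a possibly smaller domain. -/
theorem isTransient_of_same_quadratic_form [SigmaFinite μ] {B B' : PartialForm (Lp ℝ 2 μ)}
    (hB : IsDirichletForm B) (hsec : IsSectorial B) (hB' : IsDirichletForm B')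
    (hle : ∀ u : B'.dom, ∃ v : B.dom, (v : Lp ℝ 2 μ) = u ∧ B.form v v = B'.form u u)
    {T T' : ℝ → Lp ℝ 2 μ →L[ℝ] Lp ℝ 2 μ} (hT : IsFormSemigroup B T)
    (hT' : IsFormSemigroup B' T') (htr : IsTransient T) : IsTransient T' := by
  have hadj : ∀ t : ℝ, 0 < t → IsSubMarkovian (ContinuousLinearMap.adjoint (T' t)) :=
    fun t ht => hT'.adjoint_isSubMarkovian hB' ht
  obtain ⟨hT'0, G, L, hG, hLG, hLT⟩ := hT'
  refine isTransient_of_domination hB hsec hT hT'0 hLT hLG hadj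
    (fun α hα => IsFormResolvent.isSubMarkovian hB' hG hα) (fun α hα f _ => ?_) htr
  obtain ⟨u, hu, hform⟩ := hG.2 α hα f
  obtain ⟨v, hv, hvu⟩ := hle u
  refine ⟨v, hv.trans hu, ?_⟩
  have h1 := hform u
  have h2 : 0 ≤ α * inner ℝ (u : Lp ℝ 2 μ) (u : Lp ℝ 2 μ) :=
    mul_nonneg hα.le real_inner_self_nonneg
  rw [hvu, ← hu]
  linarith

end Domination

end GenDirichlet

end

theorem theorem2p4 {E : Type*} [TopologicalSpace E] [T2Space E] [MeasurableSpace E] [BorelSpace E]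
    (hE : borel E = ⨆ f : C(E, ℝ), MeasurableSpace.comap f (borel ℝ))
    (μ : Measure E) [SigmaFinite μ] :
    -- the domination principle
    (∀ (A : GenDirichlet.PartialForm (Lp ℝ 2 μ))
        (Λ : Lp ℝ 2 μ →ₗ.[ℝ] Lp ℝ 2 μ) (U : ℝ → Lp ℝ 2 μ →L[ℝ] Lp ℝ 2 μ)
        (L : Lp ℝ 2 μ →ₗ.[ℝ] Lp ℝ 2 μ) (T : ℝ → Lp ℝ 2 μ →L[ℝ] Lp ℝ 2 μ),
      GenDirichlet.IsDirichletForm A →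
      GenDirichlet.IsC0ContractionSemigroup U →
      GenDirichlet.IsSemigroupGenerator Λ U →
      (∀ t : ℝ, 0 < t → GenDirichlet.IsSubMarkovian (U t)) →
      GenDirichlet.RestrictsToC0Semigroup U A →
      GenDirichlet.IsGenFormSemigroup A Λ L T →
      (∀ t : ℝ, 0 < t → GenDirichlet.IsSubMarkovian (ContinuousLinearMap.adjoint (T t))) →
      ∀ (E₀ : GenDirichlet.PartialForm (Lp ℝ 2 μ)) (T₀ : ℝ → Lp ℝ 2 μ →L[ℝ] Lp ℝ 2 μ),
        GenDirichlet.IsDirichletForm E₀ →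
        GenDirichlet.IsSectorial E₀ →
        GenDirichlet.IsFormSemigroup E₀ T₀ →
        (∀ u ∈ L.domain, GenDirichlet.IsEssBounded u → u ∈ E₀.dom) →
        (∀ (u₀ : E₀.dom) (u : A.dom), (u₀ : Lp ℝ 2 μ) = (u : Lp ℝ 2 μ) →
          (u : Lp ℝ 2 μ) ∈ L.domain → GenDirichlet.IsEssBounded (u : Lp ℝ 2 μ) →
          E₀.form u₀ u₀ ≤ GenDirichlet.genForm A Λ u u) →
        GenDirichlet.IsTransient T₀ → GenDirichlet.IsTransient T) ∧
    -- the symmetric part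
    (∀ E₀ : GenDirichlet.PartialForm (Lp ℝ 2 μ),
      GenDirichlet.IsDirichletForm E₀ →
      GenDirichlet.IsSectorial E₀ →
      GenDirichlet.IsDirichletForm E₀.symPart ∧
      ∀ T₀ Ts : ℝ → Lp ℝ 2 μ →L[ℝ] Lp ℝ 2 μ,
        GenDirichlet.IsFormSemigroup E₀ T₀ →
        GenDirichlet.IsFormSemigroup E₀.symPart Ts →
        (GenDirichlet.IsTransient T₀ ↔ GenDirichlet.IsTransient Ts)) := by
  refine ⟨?_, ?_⟩
  · intro A Λ U L T hA hU hΛ hUsub _ hT hadj E₀ T₀ hE₀ hsec hT₀ hdom hle htr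
    obtain ⟨hT, hL, G, hG, hLG⟩ := hT
    refine GenDirichlet.isTransient_of_domination hE₀ hsec hT₀ hT hL hLG hadj
      (fun α hα => GenDirichlet.IsGenFormResolvent.isSubMarkovian hA hU hΛ hUsub hG hα)
      (fun α hα f hbdd => ?_) htr
    obtain ⟨u, -, hu, hform⟩ := hG.2 α hα f
    have hmem : G α f ∈ L.domain :=
      LinearPMap.mem_domain_of_mem_graph (GenDirichlet.resolvent_apply_mem_graph hLG hα f)
    refine ⟨⟨G α f, hdom _ hmem hbdd⟩, rfl, ?_⟩
    have h1 := hle ⟨G α f, hdom _ hmem hbdd⟩ u hu.symm (hu ▸ hmem) (hu ▸ hbdd)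
    have h2 := hform u
    have h3 : 0 ≤ α * inner ℝ (u : Lp ℝ 2 μ) (u : Lp ℝ 2 μ) :=
      mul_nonneg hα.le real_inner_self_nonneg
    rw [hu] at h2 h3
    linarith
  · intro E₀ hE₀ hsec
    refine ⟨hE₀.symPart, fun T₀ Ts hT₀ hTs => ⟨fun h => ?_, fun h => ?_⟩⟩
    · exact GenDirichlet.isTransient_of_same_quadratic_form hE₀ hsec hE₀.symPart
        (fun (u : E₀.dom) => ⟨u, rfl, (GenDirichlet.symPart_form_self E₀ u).symm⟩) hT₀ hTs h
    · exact GenDirichlet.isTransient_of_same_quadratic_form hE₀.symPart hsec.symPart hE₀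
        (fun (u : E₀.dom) => ⟨u, rfl, GenDirichlet.symPart_form_self E₀ u⟩) hTs hT₀ h
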